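/- Let $\mathcal X=\mathcal Y=[0,1]^{\mathbb N}$ with the product $\sigma$-algebra, let $\mu_X=\mu_Y$ be the law of a sequence of independent $\mathrm{Unif}[0,1]$ random variables, and let $\mu=\mu_X\otimes\mu_Y$. Let $\mathcal J=\mathcal K$ be the set of pairs $(a,m)\neq(1,0)$ with $a\in\{0,1\}$ and $m=(m_1,m_2,\ldots)$ a sequence of non-negative integers with finitely many non-zero entries; for $j=(a,m)$ put $|j|=\max_{\ell\ge1}\ell^2m_\ell$. Let $p_{0,0}=1$ and, for $m\ne0$, $p_{a,m}(x)=2^{1/2}\,\mathrm{Re}\bigl(e^{-a\pi i/2}\prod_{\ell\ge1}e^{-2\pi i m_\ell x_\ell}\bigr)$. For a measurable $f\in L^2(\mu)$ with $f\ge0$ $\mu$-a.e. and $\int f\,d\mu=1$ (a density; the set of these is $\mathcal F$), let $f_X,f_Y$ be its marginal densities, $a_{jk}(f)=\int f(x,y)p_j(x)p_k(y)\,d\mu(x,y)$, $a_{j\bullet}(f)=\int f_Xp_j\,d\mu_X$, $a_{\bullet k}(f)=\int f_Yp_k\,d\mu_Y$, $D(f)=\int\{f(x,y)-f_X(x)f_Y(y)\}^2\,d\mu(x,y)$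 and, for an array $\theta=(\theta_{jk})$ with values in $[0,\infty]$, $S_\theta(f)=\sum_{j\in\mathcal J}\sum_{k\in\mathcal K}\theta_{jk}^2\{a_{jk}(f)-a_{j\bullet}(f)a_{\bullet k}(f)\}^2$. For $\xi=(\theta,r,A)$ and $\rho>0$ let $$\mathcal F_\xi(\rho)=\bigl\{f\in\mathcal F: D(f)\ge\rho^2,\ S_\theta(f)\le r^2,\ \max(\|f\|_\infty,\|f_X\|_\infty,\|f_Y\|_\infty)\le A\bigr\},$$ where $\|\cdot\|_\infty$ is the supremum of the absolute value. Let $\Psi(\alpha)$ be the set of measurable $\psi:(\mathcal X\times\mathcal Y)^n\to[0,1]$ with $\mathbb E_P(\psi)\le\alpha$ for every law $P$ on $\mathcal X\times\mathcal Y$ of a pair with independent components (the expectation being over $n$ independent observations from $P$), let $\mathcal R(n,\alpha,\xi,\rho)=\alpha+\inf_{\psi\in\Psi(\alpha)}\sup_{f\in\mathcal F_\xi(\rho)}\mathbb E_f(1-\psi)$, with value $\alpha$ if $\mathcal F_\xi(\rho)=\emptyset$, and let $\rho^*(n,\alpha,\beta,\xi)=\inf\{\rho>0:\mathcal R(n,\alpha,\xi,\rho)\le\alpha+\beta\}$.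 For $s_X,s_Y>0$ let $s=2/(s_X^{-1}+s_Y^{-1})$, $c_0=\sum_{\ell\ge1}\{\ell^{-1/2}-(\ell+1)^{-1/2}\}\log(1+\ell)$, $M(t)=\exp\bigl(\sum_{\ell\ge1}\log(1+\lfloor t/\ell^2\rfloor)\bigr)-1$ for $t\ge0$, and $$m_{0,s_X,s_Y}(t)=\min\Bigl\{m\in\mathbb N: M\Bigl(\tfrac{\log^2(t/m^{1/2})}{4s_X^2}\Bigr)M\Bigl(\tfrac{\log^2(t/m^{1/2})}{4s_Y^2}\Bigr)<\tfrac m4\Bigr\}.$$ **Proposition.** Let $\alpha,\beta\in(0,1)$ with $\alpha+\beta<1$, let $s_X,s_Y>0$, $A>1$ and $\epsilon>0$, and let $\theta_{jk}=\max\{\exp(s_X|j|^{1/2}),\exp(s_Y|k|^{1/2})\}$ for $j\in\mathcal J$, $k\in\mathcal K$. Then there exist $C>0$ and $C'>0$, depending only on $\alpha,\beta,s_X,s_Y,A,\epsilon$, such that for all integers $n\ge1$ and all $r>0$ with $r^2\le n^{s/(s+c_0)-\epsilon}$ and $\min(n,nr^2)\ge C'$, with $\xi=(\theta,r,A)$,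 $$\rho^*(n,\alpha,\beta,\xi)\ \ge\ \frac{C\,m_{0,s_X,s_Y}(nr^2)^{1/4}}{n^{1/2}}.$$ -/

import Mathlib

open MeasureTheory ProbabilityTheory
open scoped ENNReal

noncomputable section

namespace IndepTesting

/-! ### Independence testing on general measure spaces -/

section General

variable {X Y J K : Type*} [MeasurableSpace X] [MeasurableSpace Y]

/-- The supremum norm `sup_z |f z|`, with values in `[0, ∞]`. -/
def supNorm {Z : Type*} (f : Z → ℝ) : ℝ≥0∞ := ⨆ z, ENNReal.ofReal |f z|

/-- The square-integrable probability densities on `X × Y` with respect to `μX ⊗ μY`. -/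
def densities (μX : Measure X) (μY : Measure Y) : Set (X × Y → ℝ) :=
  {f | Measurable f ∧ MemLp f 2 (μX.prod μY) ∧ (∀ᵐ z ∂(μX.prod μY), 0 ≤ f z) ∧
    ∫ z, f z ∂(μX.prod μY) = 1}

/-- The marginal density of the first coordinate. -/
def marginalX (μY : Measure Y) (f : X × Y → ℝ) (x : X) : ℝ := ∫ y, f (x, y) ∂μY

/-- The marginal density of the second coordinate. -/
def marginalY (μX : Measure X) (f : X × Y → ℝ) (y : Y) : ℝ := ∫ x, f (x, y) ∂μX

/-- The coefficient `a_{jk}(f) = ∫ f p_{jk}`, where `p_{jk}(x, y) = p_j^X(x) p_k^Y(y)`. -/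
def coeff (μX : Measure X) (μY : Measure Y) (pX : J → X → ℝ) (pY : K → Y → ℝ)
    (f : X × Y → ℝ) (j : J) (k : K) : ℝ :=
  ∫ z, f z * (pX j z.1 * pY k z.2) ∂(μX.prod μY)

/-- The coefficient `a_{j∙}(f) = ∫ f_X p_j^X`. -/
def coeffX (μX : Measure X) (μY : Measure Y) (pX : J → X → ℝ) (f : X × Y → ℝ) (j : J) : ℝ :=
  ∫ x, marginalX μY f x * pX j x ∂μX

/-- The coefficient `a_{∙k}(f) = ∫ f_Y p_k^Y`. -/
def coeffY (μX : Measure X) (μY : Measure Y) (pY : K → Y → ℝ) (f : X × Y → ℝ) (k : K) : ℝ :=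
  ∫ y, marginalY μX f y * pY k y ∂μY

/-- The measure of dependence `D(f) = ∫ (f(x,y) - f_X(x) f_Y(y))²`. -/
def dependence (μX : Measure X) (μY : Measure Y) (f : X × Y → ℝ) : ℝ :=
  ∫ z, (f z - marginalX μY f z.1 * marginalY μX f z.2) ^ 2 ∂(μX.prod μY)

/-- The smoothness functional `S_θ(f) = ∑_{j,k} θ_{jk}² (a_{jk}(f) - a_{j∙}(f) a_{∙k}(f))²`,
as a sum in `[0, ∞]`. -/
def smoothness (μX : Measure X) (μY : Measure Y) (pX : J → X → ℝ) (pY : K → Y → ℝ)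
    (θ : J → K → ℝ≥0∞) (f : X × Y → ℝ) : ℝ≥0∞ :=
  ∑' j, ∑' k, θ j k ^ 2 *
    ENNReal.ofReal ((coeff μX μY pX pY f j k - coeffX μX μY pX f j * coeffY μX μY pY f k) ^ 2)

/-- The class of alternatives `F_ξ(ρ)` for `ξ = (θ, r, A)`. -/
def alternatives (μX : Measure X) (μY : Measure Y) (pX : J → X → ℝ) (pY : K → Y → ℝ)
    (θ : J → K → ℝ≥0∞) (r A ρ : ℝ) : Set (X × Y → ℝ) :=
  {f | f ∈ densities μX μY ∧ ρ ^ 2 ≤ dependence μX μY f ∧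
    smoothness μX μY pX pY θ f ≤ ENNReal.ofReal (r ^ 2) ∧
    max (supNorm f) (max (supNorm (marginalX μY f)) (supNorm (marginalY μX f))) ≤
      ENNReal.ofReal A}

/-- The randomised tests based on `n` observations: measurable functions
`(X × Y)^n → [0, 1]`. -/
def randomisedTests (X Y : Type*) [MeasurableSpace X] [MeasurableSpace Y] (n : ℕ) :
    Set ((Fin n → X × Y) → ℝ) :=
  {ψ | Measurable ψ ∧ ∀ w, ψ w ∈ Set.Icc (0 : ℝ) 1}

/-- The expectation `E_P(W)` of a function `W` of `n` independent observations from `P`. -/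
def sampleExpectation (P : Measure (X × Y)) (n : ℕ) (W : (Fin n → X × Y) → ℝ) : ℝ :=
  ∫ w, W w ∂(Measure.pi fun _ : Fin n => P)

/-- All laws of pairs with independent components. -/
def nullLaws (X Y : Type*) [MeasurableSpace X] [MeasurableSpace Y] : Set (Measure (X × Y)) :=
  {P | IsProbabilityMeasure P ∧ IndepFun (Prod.fst : X × Y → X) (Prod.snd : X × Y → Y) P}

/-- The tests of size at most `α` over the whole composite null hypothesis. -/
def validTests (X Y : Type*) [MeasurableSpace X] [MeasurableSpace Y] (n : ℕ) (α : ℝ) :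
    Set ((Fin n → X × Y) → ℝ) :=
  {ψ | ψ ∈ randomisedTests X Y n ∧ ∀ P ∈ nullLaws X Y, sampleExpectation P n ψ ≤ α}

/-- The law on `X × Y` with density `f`. -/
def lawOfDensity (μX : Measure X) (μY : Measure Y) (f : X × Y → ℝ) : Measure (X × Y) :=
  (μX.prod μY).withDensity fun z => ENNReal.ofReal (f z)

/-- The worst Type II error `sup_{f ∈ F} E_f(1 - ψ)`; it is `0` if the class `F` is empty. -/
def worstTypeII (μX : Measure X) (μY : Measure Y) (n : ℕ) (F : Set (X × Y → ℝ))
    (ψ : (Fin n → X × Y) → ℝ) : ℝ :=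
  sSup ((fun f => sampleExpectation (lawOfDensity μX μY f) n fun w => 1 - ψ w) '' F)

/-- The minimax risk `α + inf_{ψ ∈ Ψ(α)} sup_{f ∈ F_ξ(ρ)} E_f(1 - ψ)` (for `0 ≤ α`, its value
is `α` if `F_ξ(ρ)` is empty, because the supremum is then `0`). -/
def testingRisk (μX : Measure X) (μY : Measure Y) (pX : J → X → ℝ) (pY : K → Y → ℝ)
    (n : ℕ) (α : ℝ) (θ : J → K → ℝ≥0∞) (r A ρ : ℝ) : ℝ :=
  α + sInf (worstTypeII μX μY n (alternatives μX μY pX pY θ r A ρ) '' validTests X Y n α)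

/-- The minimax separation radius `ρ*(n, α, β, ξ)` for `ξ = (θ, r, A)`. -/
def separationRadius (μX : Measure X) (μY : Measure Y) (pX : J → X → ℝ) (pY : K → Y → ℝ)
    (n : ℕ) (α β : ℝ) (θ : J → K → ℝ≥0∞) (r A : ℝ) : ℝ :=
  sInf {ρ : ℝ | 0 < ρ ∧ testingRisk μX μY pX pY n α θ r A ρ ≤ α + β}

end General

/-! ### The infinite-dimensional example

Coordinates are indexed from `0` here, so that coordinate `l` plays the role of `ℓ = l + 1`. -/

/-- The infinite-dimensional cube `[0,1]^ℕ`, with its product σ-algebra. -/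
abbrev Cube : Type := ℕ → unitInterval

/-- The law of an infinite sequence of independent uniform variables on `[0,1]`. -/
def cubeMeasure : Measure Cube := Measure.infinitePi fun _ : ℕ => (volume : Measure unitInterval)

/-- Pairs `(a, m) ≠ (1, 0)` with `a ∈ {0,1}` and `m` a finitely supported sequence in `ℕ₀`. -/
abbrev FourierIndex : Type := {j : Fin 2 × (ℕ →₀ ℕ) // j ≠ (1, 0)}

/-- `|(a, m)| = max_ℓ ℓ² m_ℓ`. -/
def FourierIndex.size (j : FourierIndex) : ℕ :=
  j.1.2.support.sup fun l => (l + 1) ^ 2 * j.1.2 l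

/-- The Fourier functions: `p_{0,0} = 1` and, for `m ≠ 0`,
`p_{a,m}(x) = √2 Re (e^{-aπi/2} ∏_ℓ e^{-2πi m_ℓ x_ℓ})`. -/
def fourierFun (j : FourierIndex) (x : Cube) : ℝ :=
  if j.1.2 = 0 then 1 else
    Real.sqrt 2 * (Complex.exp (-((j.1.1 : ℕ) : ℂ) * Real.pi * Complex.I / 2) *
      j.1.2.prod fun l k => Complex.exp (-2 * Real.pi * Complex.I * k * ((x l : ℝ) : ℂ))).re

/-- The weights `θ_{jk} = max (exp (s_X |j|^{1/2})) (exp (s_Y |k|^{1/2}))`. -/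
def expWeight (sX sY : ℝ) (j k : FourierIndex) : ℝ≥0∞ :=
  ENNReal.ofReal
    (max (Real.exp (sX * Real.sqrt j.size)) (Real.exp (sY * Real.sqrt k.size)))

/-- `M(t) = exp (∑_{ℓ ≥ 1} log (1 + ⌊t/ℓ²⌋)) - 1`, for `t ≥ 0` (a finite sum). -/
def countM (t : ℝ) : ℝ :=
  Real.exp (∑' l : ℕ, Real.log (1 + (⌊t / ((l : ℝ) + 1) ^ 2⌋₊ : ℝ))) - 1

/-- `m_{0,s_X,s_Y}(t)`: the least `m ≥ 1` with
`M(log²(t/m^{1/2})/(4 s_X²)) M(log²(t/m^{1/2})/(4 s_Y²)) < m/4`. -/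
def truncLevel (sX sY t : ℝ) : ℕ :=
  sInf {m : ℕ | 1 ≤ m ∧
    countM (Real.log (t / Real.sqrt m) ^ 2 / (4 * sX ^ 2)) *
      countM (Real.log (t / Real.sqrt m) ^ 2 / (4 * sY ^ 2)) < (m : ℝ) / 4}

/-- `s = 2 / (1/s_X + 1/s_Y)`. -/
def meanSmoothness (sX sY : ℝ) : ℝ := 2 / (sX⁻¹ + sY⁻¹)

/-- `c₀ = ∑_{ℓ ≥ 1} (ℓ^{-1/2} - (ℓ+1)^{-1/2}) log (1 + ℓ)`. -/
def effectiveDim : ℝ :=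
  ∑' l : ℕ, ((Real.sqrt ((l : ℝ) + 1))⁻¹ - (Real.sqrt ((l : ℝ) + 2))⁻¹) *
    Real.log ((l : ℝ) + 2)

/-- The minimax separation radius in the infinite-dimensional example. -/
def cubeRadius (n : ℕ) (α β sX sY r A : ℝ) : ℝ :=
  separationRadius cubeMeasure cubeMeasure fourierFun fourierFun n α β (expWeight sX sY) r A

end IndepTesting

end

/-! The bound is Le Cam's method: the uniform law, which has independent components, is compared
with a mixture of the alternatives f_σ = 1 + δ ∑_{i ≤ m} σ_i p_{j_i}(x) p_{k_i}(y), where σ is a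
vector of signs and the (j_i, k_i) are distinct pairs of non-constant indices. By orthonormality f_σ
has uniform marginals, D(f_σ) = mδ², and ∫ f_σ f_τ = 1 + δ² ∑ σ_i τ_i. The average over σ and τ of
the n-th power of this is at most exp(m n² δ⁴ / 2) when the densities are non-negative, so a
perturbation with δ² of order 1/(n√m) goes undetected (`exists_type_two_error_ge`). The separation
is then ρ² = mδ², of order √m / n.

Take m one below the truncation level at t = nr², and put x = t/√m. Minimality of that level gives m
≤ 4 M(log²x/(4s_X²)) M(log²x/(4s_Y²)), which is the number of pairs of non-constant indices of sizes
at most the two arguments of M. On such pairs θ² ≤ x, so S_θ(f_σ) ≤ m x δ² ≤ r².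

It remains to make f_σ non-negative and bounded by A, which holds for most σ. The Fourier functions
used depend on O(log² n) coordinates, so a grid of exp(O(log³ n)) points resolves them, and a
Hoeffding bound at each grid point (`card_exists_lt_abs_sum_fourierProd_le`) fails with probability
exp(-const · n/√m). The estimate M(t) ≤ exp(c₀√t) of `countM_le_exp`, together with r² ≤
n^{s/(s+c₀)}, gives √m ≤ 2 n^{1-s/(s+c₀)}. Hence n/√m is at least a positive power of n and
dominates log³ n. Keeping a proportion at least q of the signs costs only a factor q⁻² in the second
moment. -/

namespace IndepTesting

/-! ### Orthonormality and Lipschitz bounds for the Fourier functions -/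

section Fourier

instance : IsProbabilityMeasure cubeMeasure := by
  unfold cubeMeasure; infer_instance

theorem integral_unitInterval_exp (k : ℤ) :
    ∫ x : unitInterval, Complex.exp (2 * Real.pi * Complex.I * k * ((x : ℝ) : ℂ)) =
      if k = 0 then 1 else 0 := by
  split_ifs with hk
  · simp [hk]
  · have h1 : ∫ x : unitInterval, Complex.exp (2 * Real.pi * Complex.I * k * ((x : ℝ) : ℂ)) =
        ∫ x in (0 : ℝ)..1, Complex.exp (2 * Real.pi * Complex.I * k * (x : ℂ)) := by
      rw [intervalIntegral.integral_of_le zero_le_one, ← integral_Icc_eq_integral_Ioc]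
      exact integral_subtype_comap measurableSet_Icc
        (fun x : ℝ => Complex.exp (2 * Real.pi * Complex.I * k * (x : ℂ)))
    have hc : 2 * Real.pi * Complex.I * k ≠ 0 := by
      simp [Real.pi_ne_zero, hk]
    rw [h1, integral_exp_mul_complex hc]
    have : Complex.exp (2 * Real.pi * Complex.I * k) = 1 := by
      rw [mul_comm]; exact Complex.exp_int_mul_two_pi_mul_I k
    simp [this]

theorem integral_cubeMeasure_prod_exp (S : Finset ℕ) (k : ℕ → ℤ) :
    ∫ x : Cube, ∏ l ∈ S, Complex.exp (2 * Real.pi * Complex.I * k l * ((x l : ℝ) : ℂ))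
      ∂cubeMeasure = if ∀ l ∈ S, k l = 0 then 1 else 0 := by
  have h1 : ∫ x : Cube, ∏ l ∈ S, Complex.exp (2 * Real.pi * Complex.I * k l * ((x l : ℝ) : ℂ))
      ∂cubeMeasure = ∫ y : S → unitInterval, ∏ l : S,
        Complex.exp (2 * Real.pi * Complex.I * k l * ((y l : ℝ) : ℂ))
        ∂(Measure.pi fun _ => volume) := by
    rw [cubeMeasure, ← integral_restrict_infinitePi (μ := fun _ : ℕ => (volume : Measure unitInterval))]
    · refine integral_congr_ae (Filter.Eventually.of_forall fun x => ?_)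
      exact (Finset.prod_coe_sort S
        fun l => Complex.exp (2 * Real.pi * Complex.I * k l * ((x l : ℝ) : ℂ))).symm
    · exact Continuous.aestronglyMeasurable (by fun_prop)
  rw [h1, integral_fintype_prod_eq_prod (𝕜 := ℂ)
    (fun (l : S) (t : unitInterval) =>
      Complex.exp (2 * Real.pi * Complex.I * k l * ((t : ℝ) : ℂ)))]
  simp_rw [integral_unitInterval_exp]
  rw [Finset.prod_coe_sort S fun l => if k l = 0 then (1 : ℂ) else 0, Finset.prod_ite_zero]
  simp

theorem integral_cubeMeasure_cos (S : Finset ℕ) (k : ℕ → ℤ) (φ : ℝ) :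
    ∫ x : Cube, Real.cos (φ + 2 * Real.pi * ∑ l ∈ S, (k l : ℝ) * (x l : ℝ)) ∂cubeMeasure =
      if ∀ l ∈ S, k l = 0 then Real.cos φ else 0 := by
  have hexp (x : Cube) : Complex.exp (φ * Complex.I) *
      ∏ l ∈ S, Complex.exp (2 * Real.pi * Complex.I * k l * ((x l : ℝ) : ℂ)) =
      Complex.exp ((φ + 2 * Real.pi * ∑ l ∈ S, (k l : ℝ) * (x l : ℝ) : ℝ) * Complex.I) := by
    rw [← Complex.exp_sum, ← Complex.exp_add]
    congr 1
    push_cast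
    rw [add_mul, Finset.mul_sum, Finset.sum_mul]
    congr 1
    exact Finset.sum_congr rfl fun l _ => by ring
  have hre (x : Cube) : Real.cos (φ + 2 * Real.pi * ∑ l ∈ S, (k l : ℝ) * (x l : ℝ)) =
      RCLike.re (Complex.exp (φ * Complex.I) *
      ∏ l ∈ S, Complex.exp (2 * Real.pi * Complex.I * k l * ((x l : ℝ) : ℂ))) := by
    rw [hexp]; exact (Complex.exp_ofReal_mul_I_re _).symm
  have hint : Integrable (fun x : Cube => Complex.exp (φ * Complex.I) *
      ∏ l ∈ S, Complex.exp (2 * Real.pi * Complex.I * k l * ((x l : ℝ) : ℂ))) cubeMeasure := by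
    refine Integrable.of_bound (Continuous.aestronglyMeasurable (by fun_prop)) 1
      (Filter.Eventually.of_forall fun x => ?_)
    rw [hexp, Complex.norm_exp_ofReal_mul_I]
  simp_rw [hre]
  rw [integral_re hint, integral_const_mul, integral_cubeMeasure_prod_exp]
  split_ifs
  · simp [Complex.exp_ofReal_mul_I_re]
  · simp

/-- The sum may run over any finite set containing the support, so that two indices can be written
over a common set of coordinates. -/
theorem fourierFun_eq_cos (j : FourierIndex) (hj : j.1.2 ≠ 0) {S : Finset ℕ}
    (hS : j.1.2.support ⊆ S) (x : Cube) :
    fourierFun j x = Real.sqrt 2 * Real.cos ((j.1.1 : ℕ) * (Real.pi / 2) +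
      2 * Real.pi * ∑ l ∈ S, (j.1.2 l : ℝ) * (x l : ℝ)) := by
  unfold fourierFun
  rw [if_neg hj]
  congr 1
  rw [Finsupp.prod_of_support_subset _ hS _ (by simp), ← Complex.exp_sum, ← Complex.exp_add,
    ← Real.cos_neg, ← Complex.exp_ofReal_mul_I_re]
  congr 2
  push_cast
  rw [neg_add, add_mul, Finset.mul_sum, ← Finset.sum_neg_distrib, Finset.sum_mul]
  congr 1
  · ring
  · exact Finset.sum_congr rfl fun l _ => by ring

theorem measurable_fourierFun (j : FourierIndex) : Measurable (fourierFun j) := by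
  by_cases hj : j.1.2 = 0
  · have : fourierFun j = fun _ => 1 := by ext x; simp [fourierFun, hj]
    rw [this]; exact measurable_const
  · rw [funext (fourierFun_eq_cos j hj subset_rfl)]
    fun_prop

theorem abs_fourierFun_le (j : FourierIndex) (x : Cube) : |fourierFun j x| ≤ Real.sqrt 2 := by
  by_cases hj : j.1.2 = 0
  · simp [fourierFun, hj]
  · rw [fourierFun_eq_cos j hj subset_rfl, abs_mul, abs_of_nonneg (Real.sqrt_nonneg 2)]
    exact mul_le_of_le_one_right (Real.sqrt_nonneg 2) (Real.abs_cos_le_one _)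

theorem integral_fourierFun (j : FourierIndex) (hj : j.1.2 ≠ 0) :
    ∫ x, fourierFun j x ∂cubeMeasure = 0 := by
  simp_rw [fourierFun_eq_cos j hj subset_rfl]
  rw [integral_const_mul]
  have := integral_cubeMeasure_cos j.1.2.support (fun l => (j.1.2 l : ℤ))
    ((j.1.1 : ℕ) * (Real.pi / 2))
  simp only [Int.cast_natCast] at this
  rw [this, if_neg, mul_zero]
  intro h
  exact hj (Finsupp.support_eq_empty.1 (Finset.eq_empty_of_forall_notMem fun l hl =>
    Finsupp.mem_support_iff.1 hl (by exact_mod_cast h l hl)))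

/-- Product-to-sum: the summed frequency never vanishes, since entries are non-negative and `j` is
non-constant. The difference vanishes only for equal frequencies, where a mismatch of the phases
leaves cos(±π/2) = 0. -/
theorem integral_fourierFun_mul (j k : FourierIndex) (hj : j.1.2 ≠ 0) (hk : k.1.2 ≠ 0) :
    ∫ x, fourierFun j x * fourierFun k x ∂cubeMeasure = if j = k then 1 else 0 := by
  set S := j.1.2.support ∪ k.1.2.support with hS
  have hprod (x : Cube) : fourierFun j x * fourierFun k x =
      Real.cos (((j.1.1 : ℕ) + (k.1.1 : ℕ)) * (Real.pi / 2) +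
        2 * Real.pi * ∑ l ∈ S, (((j.1.2 l : ℤ) + (k.1.2 l : ℤ) : ℤ) : ℝ) * (x l : ℝ)) +
      Real.cos (((j.1.1 : ℕ) - (k.1.1 : ℕ)) * (Real.pi / 2) +
        2 * Real.pi * ∑ l ∈ S, (((j.1.2 l : ℤ) - (k.1.2 l : ℤ) : ℤ) : ℝ) * (x l : ℝ)) := by
    rw [fourierFun_eq_cos j hj (S := S) Finset.subset_union_left,
      fourierFun_eq_cos k hk (S := S) Finset.subset_union_right]
    push_cast
    simp only [add_mul, sub_mul, Finset.sum_add_distrib, Finset.sum_sub_distrib]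
    rw [Real.cos_add_cos]
    have h2 : Real.sqrt 2 * Real.sqrt 2 = 2 := Real.mul_self_sqrt (by norm_num)
    rw [mul_mul_mul_comm, h2, ← mul_assoc]
    congr 2
    · congr 2; ring
    · ring
  have hint (φ : ℝ) (q : ℕ → ℤ) : Integrable (fun x : Cube =>
      Real.cos (φ + 2 * Real.pi * ∑ l ∈ S, (q l : ℝ) * (x l : ℝ))) cubeMeasure :=
    Integrable.of_bound (Continuous.aestronglyMeasurable (by fun_prop)) 1
      (Filter.Eventually.of_forall fun x => Real.abs_cos_le_one _)
  simp_rw [hprod]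
  rw [integral_add (hint _ fun l => (j.1.2 l : ℤ) + (k.1.2 l : ℤ))
      (hint _ fun l => (j.1.2 l : ℤ) - (k.1.2 l : ℤ)),
    integral_cubeMeasure_cos S fun l => (j.1.2 l : ℤ) + (k.1.2 l : ℤ),
    integral_cubeMeasure_cos S fun l => (j.1.2 l : ℤ) - (k.1.2 l : ℤ), if_neg, zero_add]
  · by_cases hjk : j.1.2 = k.1.2
    · rw [if_pos (by simp [hjk])]
      by_cases ha : j.1.1 = k.1.1
      · rw [if_pos (Subtype.ext (Prod.ext ha hjk))]
        simp [ha]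
      · rw [if_neg fun h => ha (by rw [h])]
        generalize j.1.1 = a at ha
        generalize k.1.1 = b at ha
        fin_cases a <;> fin_cases b <;> simp_all
    · rw [if_neg, if_neg fun h => hjk (by rw [h])]
      intro h
      refine hjk (Finsupp.ext fun l => ?_)
      by_cases hl : l ∈ S
      · have := h l hl; omega
      · simp only [hS, Finset.mem_union, Finsupp.mem_support_iff, not_or, not_not] at hl
        omega
  · intro h
    refine hj (Finsupp.ext fun l => ?_)
    by_cases hl : l ∈ S
    · have := h l hl; simp only [Finsupp.coe_zero, Pi.zero_apply]; omega
    · simp only [hS, Finset.mem_union, Finsupp.mem_support_iff, not_or, not_not] at hl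
      exact hl.1

theorem FourierIndex.sq_mul_le_size (j : FourierIndex) (l : ℕ) :
    (l + 1) ^ 2 * j.1.2 l ≤ j.size := by
  by_cases hl : l ∈ j.1.2.support
  · exact Finset.le_sup (f := fun l => (l + 1) ^ 2 * j.1.2 l) hl
  · simp [Finsupp.notMem_support_iff.1 hl]

theorem FourierIndex.support_subset_range (j : FourierIndex) {T : ℕ} (hT : j.size ≤ T) :
    j.1.2.support ⊆ Finset.range T := by
  intro l hl
  have h1 := j.sq_mul_le_size l
  have h2 : 1 ≤ j.1.2 l := Nat.one_le_iff_ne_zero.2 (Finsupp.mem_support_iff.1 hl)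
  rw [Finset.mem_range]
  nlinarith [Nat.mul_le_mul_left ((l + 1) ^ 2) h2]

theorem FourierIndex.apply_le_size (j : FourierIndex) (l : ℕ) : j.1.2 l ≤ j.size :=
  (Nat.le_mul_of_pos_left _ (by positivity)).trans (j.sq_mul_le_size l)

/-- The phase involves only the first `T` coordinates, each with a coefficient at most `T`, so it
moves by at most 2πT²d. -/
theorem abs_fourierFun_sub_le (j : FourierIndex) {T : ℕ} (hT : j.size ≤ T) {x x' : Cube}
    {d : ℝ} (hd : 0 ≤ d) (hx : ∀ l < T, |(x l : ℝ) - x' l| ≤ d) :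
    |fourierFun j x - fourierFun j x'| ≤ Real.sqrt 2 * (2 * Real.pi * (T ^ 2 * d)) := by
  by_cases hj : j.1.2 = 0
  · simp only [fourierFun, hj, if_true, sub_self, abs_zero]
    positivity
  · have hS := j.support_subset_range hT
    rw [fourierFun_eq_cos j hj hS, fourierFun_eq_cos j hj hS, ← mul_sub, abs_mul,
      abs_of_nonneg (Real.sqrt_nonneg 2)]
    gcongr
    refine (Real.abs_cos_sub_cos_le _ _).trans ?_
    rw [add_sub_add_left_eq_sub, ← mul_sub, ← Finset.sum_sub_distrib, abs_mul,
      abs_of_pos Real.two_pi_pos]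
    gcongr
    refine (Finset.abs_sum_le_sum_abs _ _).trans ?_
    refine (Finset.sum_le_card_nsmul _ _ (T * d) fun l hl => ?_).trans_eq ?_
    · rw [← mul_sub, abs_mul, Nat.abs_cast]
      gcongr
      · exact_mod_cast (j.apply_le_size l).trans hT
      · exact hx l (Finset.mem_range.1 hl)
    · simp; ring

end Fourier

/-! ### Exponential moments and deviations of Rademacher sums -/

section Signs

/-- The sign `±1` encoded by a Boolean. -/
noncomputable def boolSign (b : Bool) : ℝ := if b then 1 else -1

theorem boolSign_sq (b : Bool) : boolSign b ^ 2 = 1 := by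
  cases b <;> simp [boolSign]

theorem abs_boolSign (b : Bool) : |boolSign b| = 1 := by
  cases b <;> simp [boolSign]

variable {ι : Type*} [Fintype ι] [DecidableEq ι]

theorem sum_exp_boolSign_le (c : ι → ℝ) :
    ∑ σ : ι → Bool, Real.exp (∑ i, boolSign (σ i) * c i) ≤
      2 ^ Fintype.card ι * Real.exp ((∑ i, c i ^ 2) / 2) := by
  have h1 : ∑ σ : ι → Bool, Real.exp (∑ i, boolSign (σ i) * c i) =
      ∏ i, (2 * Real.cosh (c i)) := by
    simp_rw [Real.exp_sum]
    rw [← Fintype.prod_sum fun i (b : Bool) => Real.exp (boolSign b * c i)]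
    refine Finset.prod_congr rfl fun i _ => ?_
    rw [Fintype.sum_bool, Real.cosh_eq]
    simp only [boolSign]
    norm_num
    ring
  rw [h1, Finset.prod_mul_distrib, Finset.sum_div, Real.exp_sum]
  simp only [Finset.prod_const, Finset.card_univ]
  gcongr with i
  exact Real.cosh_le_exp_half_sq _

/-- For fixed `τ` the inner sum is a Rademacher exponential moment with coefficients ±a, so its
bound does not depend on `τ`. -/
theorem sum_sum_exp_boolSign_le (a : ℝ) :
    ∑ σ : ι → Bool, ∑ τ : ι → Bool, Real.exp (a * ∑ i, boolSign (σ i) * boolSign (τ i)) ≤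
      (2 ^ Fintype.card ι) ^ 2 * Real.exp (Fintype.card ι * a ^ 2 / 2) := by
  have h (τ : ι → Bool) :
      ∑ σ : ι → Bool, Real.exp (a * ∑ i, boolSign (σ i) * boolSign (τ i)) ≤
        2 ^ Fintype.card ι * Real.exp (Fintype.card ι * a ^ 2 / 2) := by
    have := sum_exp_boolSign_le fun i => a * boolSign (τ i)
    simp only [mul_pow, boolSign_sq, mul_one, Finset.sum_const, Finset.card_univ,
      nsmul_eq_mul] at this
    refine le_of_eq_of_le (Finset.sum_congr rfl fun σ _ => ?_) this
    rw [Finset.mul_sum]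
    exact congrArg _ (Finset.sum_congr rfl fun i _ => by ring)
  rw [Finset.sum_comm]
  refine (Finset.sum_le_card_nsmul _ _ _ fun τ _ => h τ).trans_eq ?_
  simp [Fintype.card_pi]
  ring

/-- Chernoff's bound with the optimal exponential parameter v/V. -/
theorem card_lt_sum_boolSign_le (c : ι → ℝ) {v V : ℝ} (hV : 0 < V) (hv : 0 ≤ v)
    (hc : ∑ i, c i ^ 2 ≤ V) :
    ((Finset.univ.filter fun σ : ι → Bool => v < ∑ i, boolSign (σ i) * c i).card : ℝ) ≤
      2 ^ Fintype.card ι * Real.exp (-(v ^ 2 / (2 * V))) := by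
  set F := Finset.univ.filter fun σ : ι → Bool => v < ∑ i, boolSign (σ i) * c i
  have h1 : (F.card : ℝ) * Real.exp (v / V * v) ≤
      ∑ σ : ι → Bool, Real.exp (∑ i, boolSign (σ i) * (v / V * c i)) := by
    rw [← nsmul_eq_mul]
    refine (Finset.card_nsmul_le_sum F _ _ fun σ hσ => ?_).trans
      (Finset.sum_le_sum_of_subset_of_nonneg F.subset_univ fun _ _ _ => (Real.exp_pos _).le)
    refine Real.exp_le_exp.2 ?_
    have h2 := (Finset.mem_filter.1 hσ).2
    have h3 : ∑ i, boolSign (σ i) * (v / V * c i) = v / V * ∑ i, boolSign (σ i) * c i := by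
      rw [Finset.mul_sum]
      exact Finset.sum_congr rfl fun i _ => by ring
    rw [h3]
    gcongr
  have h4 : (F.card : ℝ) * Real.exp (v / V * v) ≤
      2 ^ Fintype.card ι * Real.exp (v ^ 2 / (2 * V)) := by
    refine (h1.trans (sum_exp_boolSign_le _)).trans ?_
    gcongr 2 ^ Fintype.card ι * Real.exp ?_
    simp only [mul_pow, ← Finset.mul_sum]
    calc (v / V) ^ 2 * (∑ i, c i ^ 2) / 2 ≤ (v / V) ^ 2 * V / 2 := by gcongr
      _ = v ^ 2 / (2 * V) := by field_simp
  have h5 : Real.exp (-(v ^ 2 / (2 * V))) =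
      Real.exp (v ^ 2 / (2 * V)) / Real.exp (v / V * v) := by
    rw [← Real.exp_sub]
    congr 1
    field_simp
    ring
  rw [h5, ← mul_div_assoc, le_div_iff₀ (Real.exp_pos _)]
  exact h4

theorem card_lt_abs_sum_boolSign_le (c : ι → ℝ) {v V : ℝ} (hV : 0 < V) (hv : 0 ≤ v)
    (hc : ∑ i, c i ^ 2 ≤ V) :
    ((Finset.univ.filter fun σ : ι → Bool => v < |∑ i, boolSign (σ i) * c i|).card : ℝ) ≤
      2 * (2 ^ Fintype.card ι * Real.exp (-(v ^ 2 / (2 * V)))) := by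
  have h1 := card_lt_sum_boolSign_le c hV hv hc
  have h2 := card_lt_sum_boolSign_le (fun i => -c i) hV hv (by simpa using hc)
  have h3 : (Finset.univ.filter fun σ : ι → Bool => v < |∑ i, boolSign (σ i) * c i|) ⊆
      (Finset.univ.filter fun σ : ι → Bool => v < ∑ i, boolSign (σ i) * c i) ∪
      (Finset.univ.filter fun σ : ι → Bool => v < ∑ i, boolSign (σ i) * -c i) := by
    intro σ hσ
    simpa [lt_abs] using hσ
  have h4 : ((Finset.univ.filter fun σ : ι → Bool => v < |∑ i, boolSign (σ i) * c i|).card : ℝ) ≤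
      (Finset.univ.filter fun σ : ι → Bool => v < ∑ i, boolSign (σ i) * c i).card +
      (Finset.univ.filter fun σ : ι → Bool => v < ∑ i, boolSign (σ i) * -c i).card := by
    exact_mod_cast (Finset.card_le_card h3).trans (Finset.card_union_le _ _)
  linarith

/-- A union bound over a finite net for the supremum of a Rademacher process. -/
theorem card_exists_lt_abs_sum_boolSign_le {Z : Type*} [Nonempty ι] (φ : ι → Z → ℝ)
    (N : Finset Z) {u e : ℝ} (hu : 0 ≤ u) (hφ : ∀ i z, |φ i z| ≤ 2)
    (hN : ∀ z, ∃ z' ∈ N, ∀ i, |φ i z - φ i z'| ≤ e) (he : Fintype.card ι * e ≤ u / 2) :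
    (Nat.card {σ : ι → Bool // ∃ z, u < |∑ i, boolSign (σ i) * φ i z|} : ℝ) ≤
      N.card * (2 * (2 ^ Fintype.card ι * Real.exp (-(u ^ 2 / (32 * Fintype.card ι))))) := by
  classical
  have hpos : (0 : ℝ) < Fintype.card ι := by exact_mod_cast Fintype.card_pos
  have hsub : (Finset.univ.filter fun σ : ι → Bool => ∃ z, u < |∑ i, boolSign (σ i) * φ i z|) ⊆
      N.biUnion fun z' => Finset.univ.filter fun σ : ι → Bool =>
        u / 2 < |∑ i, boolSign (σ i) * φ i z'| := by
    intro σ hσ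
    obtain ⟨z, hz⟩ := (Finset.mem_filter.1 hσ).2
    obtain ⟨z', hz', hd⟩ := hN z
    refine Finset.mem_biUnion.2 ⟨z', hz', Finset.mem_filter.2 ⟨Finset.mem_univ _, ?_⟩⟩
    have h1 : |∑ i, boolSign (σ i) * φ i z - ∑ i, boolSign (σ i) * φ i z'| ≤ u / 2 := by
      rw [← Finset.sum_sub_distrib]
      refine (Finset.abs_sum_le_sum_abs _ _).trans (le_trans ?_ he)
      refine (Finset.sum_le_card_nsmul _ _ e fun i _ => ?_).trans_eq (by simp)
      rw [← mul_sub, abs_mul, abs_boolSign, one_mul]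
      exact hd i
    have h2 := abs_sub_abs_le_abs_sub (∑ i, boolSign (σ i) * φ i z)
      (∑ i, boolSign (σ i) * φ i z')
    linarith
  rw [Nat.card_eq_fintype_card, Fintype.card_subtype]
  have hle : ((Finset.univ.filter fun σ : ι → Bool =>
      ∃ z, u < |∑ i, boolSign (σ i) * φ i z|).card : ℝ) ≤
      ∑ z' ∈ N, ((Finset.univ.filter fun σ : ι → Bool =>
        u / 2 < |∑ i, boolSign (σ i) * φ i z'|).card : ℝ) := by
    exact_mod_cast (Finset.card_le_card hsub).trans Finset.card_biUnion_le
  refine hle.trans ((Finset.sum_le_card_nsmul _ _ _ fun z' _ => ?_).trans_eq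
    (nsmul_eq_mul _ _))
  -- Variance proxy 4·card at deviation u/2 produces the exponent (u/2)²/(8·card) = u²/(32·card);
  -- the other u/2 was spent on the net error.
  have hV : ∑ i, φ i z' ^ 2 ≤ 4 * Fintype.card ι := by
    refine (Finset.sum_le_card_nsmul _ _ 4 fun i _ => ?_).trans_eq (by simp; ring)
    rw [← sq_abs]
    nlinarith [hφ i z', abs_nonneg (φ i z')]
  refine (card_lt_abs_sum_boolSign_le (fun i => φ i z') (by positivity)
    (by positivity) hV).trans_eq ?_
  congr 4
  field_simp
  ring

end Signs

/-! ### A finite grid for functions of finitely many coordinates -/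

section Net

/-- The point of the cube whose first `T` coordinates are given multiples of `1/G`. -/
noncomputable def gridPoint (T G : ℕ) (v : Fin T → Fin (G + 1)) : Cube := fun l =>
  if h : l < T then ⟨(v ⟨l, h⟩ : ℕ) / G, by positivity,
    div_le_one_of_le₀ (by exact_mod_cast Nat.lt_succ_iff.1 (v ⟨l, h⟩).2) (by positivity)⟩ else 0

theorem exists_gridPoint_near {T G : ℕ} (hG : 0 < G) (x : Cube) :
    ∃ v : Fin T → Fin (G + 1), ∀ l < T, |(x l : ℝ) - gridPoint T G v l| ≤ 1 / G := by
  have hG' : (0 : ℝ) < G := by exact_mod_cast hG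
  have hx (l : ℕ) : 0 ≤ (G : ℝ) * x l := mul_nonneg hG'.le (x l).2.1
  refine ⟨fun l => ⟨⌊(G : ℝ) * x l⌋₊, Nat.lt_succ_of_le (Nat.floor_le_of_le ?_)⟩, fun l hl => ?_⟩
  · exact mul_le_of_le_one_right hG'.le (x l).2.2
  · simp only [gridPoint, hl, dif_pos]
    have h1 := Nat.floor_le (hx l)
    have h2 := Nat.lt_floor_add_one ((G : ℝ) * x l)
    rw [abs_le]
    constructor
    · rw [← sub_nonneg]
      have : (x l : ℝ) - ⌊(G : ℝ) * x l⌋₊ / G - -(1 / G) =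
        (G * x l - ⌊(G : ℝ) * x l⌋₊ + 1) / G := by field_simp; ring
      rw [this]
      exact div_nonneg (by linarith) hG'.le
    · rw [sub_le_iff_le_add, ← add_div, le_div_iff₀ hG']
      linarith

/-- The tensor product of two Fourier functions. -/
noncomputable def fourierProd (b : FourierIndex × FourierIndex) (z : Cube × Cube) : ℝ :=
  fourierFun b.1 z.1 * fourierFun b.2 z.2

theorem abs_fourierProd_le (b : FourierIndex × FourierIndex) (z : Cube × Cube) :
    |fourierProd b z| ≤ 2 := by
  rw [fourierProd, abs_mul, ← Real.mul_self_sqrt (zero_le_two (α := ℝ))]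
  exact mul_le_mul (abs_fourierFun_le _ _) (abs_fourierFun_le _ _) (abs_nonneg _)
    (Real.sqrt_nonneg _)

theorem abs_fourierProd_sub_le (b : FourierIndex × FourierIndex) {T : ℕ} (h1 : b.1.size ≤ T)
    (h2 : b.2.size ≤ T) {z z' : Cube × Cube} {d : ℝ} (hd : 0 ≤ d)
    (hx : ∀ l < T, |(z.1 l : ℝ) - z'.1 l| ≤ d) (hy : ∀ l < T, |(z.2 l : ℝ) - z'.2 l| ≤ d) :
    |fourierProd b z - fourierProd b z'| ≤ 8 * Real.pi * (T ^ 2 * d) := by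
  have e : fourierProd b z - fourierProd b z' =
      (fourierFun b.1 z.1 - fourierFun b.1 z'.1) * fourierFun b.2 z.2 +
      fourierFun b.1 z'.1 * (fourierFun b.2 z.2 - fourierFun b.2 z'.2) := by
    unfold fourierProd; ring
  have k1 := abs_fourierFun_sub_le b.1 h1 hd hx
  have k2 := abs_fourierFun_sub_le b.2 h2 hd hy
  rw [e]
  refine (abs_add_le _ _).trans ?_
  rw [abs_mul, abs_mul]
  have h3 := mul_le_mul k1 (abs_fourierFun_le b.2 z.2) (abs_nonneg _) (by positivity)
  have h4 := mul_le_mul (abs_fourierFun_le b.1 z'.1) k2 (abs_nonneg _) (by positivity)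
  have h5 : Real.sqrt 2 * Real.sqrt 2 = 2 := Real.mul_self_sqrt (by norm_num)
  calc _ ≤ _ := add_le_add h3 h4
    _ = (Real.sqrt 2 * Real.sqrt 2) * (4 * Real.pi * (T ^ 2 * d)) := by ring
    _ = _ := by rw [h5]; ring

theorem card_exists_lt_abs_sum_fourierProd_le {ι : Type*} [Fintype ι] [DecidableEq ι] [Nonempty ι]
    (b : ι → FourierIndex × FourierIndex) {T G : ℕ} (hG : 0 < G)
    (hb : ∀ i, (b i).1.size ≤ T ∧ (b i).2.size ≤ T) {u : ℝ} (hu : 0 ≤ u)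
    (he : Fintype.card ι * (8 * Real.pi * (T ^ 2 * (1 / G))) ≤ u / 2) :
    (Nat.card {σ : ι → Bool // ∃ z, u < |∑ i, boolSign (σ i) * fourierProd (b i) z|} : ℝ) ≤
      ((G : ℝ) + 1) ^ (2 * T) *
        (2 * (2 ^ Fintype.card ι * Real.exp (-(u ^ 2 / (32 * Fintype.card ι))))) := by
  classical
  set N : Finset (Cube × Cube) := (Finset.univ : Finset ((Fin T → Fin (G + 1)) ×
    (Fin T → Fin (G + 1)))).image fun v => (gridPoint T G v.1, gridPoint T G v.2)
  have hNcard : (N.card : ℝ) ≤ ((G : ℝ) + 1) ^ (2 * T) := by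
    have h : N.card ≤ (G + 1) ^ (2 * T) := by
      refine Finset.card_image_le.trans_eq ?_
      simp [two_mul, pow_add]
    exact_mod_cast h
  refine (card_exists_lt_abs_sum_boolSign_le (fun i => fourierProd (b i)) N hu
    (fun i z => abs_fourierProd_le _ _) (fun z => ?_) he).trans
    (mul_le_mul_of_nonneg_right hNcard (by positivity))
  obtain ⟨v, hv⟩ := exists_gridPoint_near (T := T) hG z.1
  obtain ⟨w, hw⟩ := exists_gridPoint_near (T := T) hG z.2
  exact ⟨(gridPoint T G v, gridPoint T G w), Finset.mem_image.2 ⟨(v, w), Finset.mem_univ _, rfl⟩,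
    fun i => abs_fourierProd_sub_le (b i) (hb i).1 (hb i).2 (by positivity) hv hw⟩

end Net

/-! ### Random-sign perturbations of the uniform density -/

section Perturbation

/-- The index of the constant Fourier function. -/
def FourierIndex.const : FourierIndex := ⟨(0, 0), by simp⟩

theorem fourierFun_const (x : Cube) : fourierFun FourierIndex.const x = 1 := by
  simp [fourierFun, FourierIndex.const]

theorem FourierIndex.eq_const_of_eq_zero {j : FourierIndex} (hj : j.1.2 = 0) :
    j = FourierIndex.const := by
  obtain ⟨⟨a, m⟩, h⟩ := j
  simp only at hj
  subst hj
  refine Subtype.ext (Prod.ext ?_ rfl)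
  fin_cases a
  · rfl
  · exact absurd rfl h

theorem integral_fourierFun_mul_fourierFun (j k : FourierIndex) :
    ∫ x, fourierFun j x * fourierFun k x ∂cubeMeasure = if j = k then 1 else 0 := by
  by_cases hj : j.1.2 = 0
  · rw [FourierIndex.eq_const_of_eq_zero hj]
    simp only [fourierFun_const, one_mul]
    by_cases hk : k.1.2 = 0
    · rw [FourierIndex.eq_const_of_eq_zero hk]
      simp [fourierFun_const]
    · rw [integral_fourierFun k hk, if_neg]
      rintro rfl
      exact hk rfl
  · by_cases hk : k.1.2 = 0
    · rw [FourierIndex.eq_const_of_eq_zero hk]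
      simp only [fourierFun_const, mul_one]
      rw [integral_fourierFun j hj, if_neg]
      rintro rfl
      exact hj rfl
    · exact integral_fourierFun_mul j k hj hk

theorem measurable_fourierProd (b : FourierIndex × FourierIndex) :
    Measurable (fourierProd b) :=
  ((measurable_fourierFun b.1).comp measurable_fst).mul
    ((measurable_fourierFun b.2).comp measurable_snd)

theorem integral_fourierProd_mul (b b' : FourierIndex × FourierIndex) :
    ∫ z, fourierProd b z * fourierProd b' z ∂(cubeMeasure.prod cubeMeasure) =
      if b = b' then 1 else 0 := by
  have h (z : Cube × Cube) : fourierProd b z * fourierProd b' z =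
      (fourierFun b.1 z.1 * fourierFun b'.1 z.1) * (fourierFun b.2 z.2 * fourierFun b'.2 z.2) := by
    unfold fourierProd; ring
  simp_rw [h]
  rw [integral_prod_mul (fun x => fourierFun b.1 x * fourierFun b'.1 x)
    (fun y => fourierFun b.2 y * fourierFun b'.2 y), integral_fourierFun_mul_fourierFun,
    integral_fourierFun_mul_fourierFun]
  by_cases h1 : b.1 = b'.1 <;> by_cases h2 : b.2 = b'.2 <;> simp [Prod.ext_iff, h1, h2]

variable {ι : Type*} [Fintype ι]

/-- The signed sum `∑ ± p_j p_k` over a finite family of index pairs. -/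
noncomputable def signedSum (b : ι → FourierIndex × FourierIndex) (σ : ι → Bool)
    (z : Cube × Cube) : ℝ := ∑ i, boolSign (σ i) * fourierProd (b i) z

/-- The perturbation `1 + δ ∑ ± p_j p_k` of the uniform density. -/
noncomputable def perturbedDensity (b : ι → FourierIndex × FourierIndex) (δ : ℝ) (σ : ι → Bool)
    (z : Cube × Cube) : ℝ := 1 + δ * signedSum b σ z

variable (b : ι → FourierIndex × FourierIndex) (δ : ℝ) (σ τ : ι → Bool)

theorem measurable_signedSum : Measurable (signedSum b σ) :=
  Finset.measurable_sum _ fun i _ => (measurable_fourierProd (b i)).const_mul _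

theorem measurable_perturbedDensity : Measurable (perturbedDensity b δ σ) :=
  ((measurable_signedSum b σ).const_mul δ).const_add 1

theorem abs_signedSum_le (z : Cube × Cube) : |signedSum b σ z| ≤ Fintype.card ι * 2 := by
  refine (Finset.abs_sum_le_sum_abs _ _).trans ?_
  refine (Finset.sum_le_card_nsmul _ _ 2 fun i _ => ?_).trans_eq (by simp)
  rw [abs_mul, abs_boolSign, one_mul]
  exact abs_fourierProd_le _ _

theorem integrable_signedSum : Integrable (signedSum b σ) (cubeMeasure.prod cubeMeasure) :=
  Integrable.of_bound (measurable_signedSum b σ).aestronglyMeasurable _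
    (Filter.Eventually.of_forall (abs_signedSum_le b σ))

theorem integrable_signedSum_mul {g : Cube × Cube → ℝ}
    (hg : Integrable g (cubeMeasure.prod cubeMeasure)) :
    Integrable (fun z => signedSum b σ z * g z) (cubeMeasure.prod cubeMeasure) :=
  hg.bdd_mul (measurable_signedSum b σ).aestronglyMeasurable
    (Filter.Eventually.of_forall (abs_signedSum_le b σ))

theorem integrable_fourierProd (p : FourierIndex × FourierIndex) :
    Integrable (fourierProd p) (cubeMeasure.prod cubeMeasure) :=
  Integrable.of_bound (measurable_fourierProd p).aestronglyMeasurable _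
    (Filter.Eventually.of_forall (abs_fourierProd_le p))

theorem integral_signedSum_mul_fourierProd (p : FourierIndex × FourierIndex) :
    ∫ z, signedSum b σ z * fourierProd p z ∂(cubeMeasure.prod cubeMeasure) =
      ∑ i, boolSign (σ i) * if b i = p then 1 else 0 := by
  simp_rw [signedSum, Finset.sum_mul, mul_assoc]
  rw [integral_finsetSum]
  · simp_rw [integral_const_mul, integral_fourierProd_mul]
  · intro i _
    refine Integrable.const_mul ?_ _
    exact (integrable_fourierProd p).bdd_mul (measurable_fourierProd _).aestronglyMeasurable
      (Filter.Eventually.of_forall (abs_fourierProd_le (b i)))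

variable {b}

theorem integral_signedSum_mul_signedSum (hb : Function.Injective b) :
    ∫ z, signedSum b σ z * signedSum b τ z ∂(cubeMeasure.prod cubeMeasure) =
      ∑ i, boolSign (σ i) * boolSign (τ i) := by
  classical
  have h (z : Cube × Cube) : signedSum b σ z * signedSum b τ z =
      ∑ k, boolSign (τ k) * (signedSum b σ z * fourierProd (b k) z) := by
    conv_lhs => rw [signedSum.eq_def b τ, Finset.mul_sum]
    exact Finset.sum_congr rfl fun k _ => by ring
  simp_rw [h]
  rw [integral_finsetSum]
  · simp_rw [integral_const_mul, integral_signedSum_mul_fourierProd, hb.eq_iff]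
    refine Finset.sum_congr rfl fun k _ => ?_
    simp [mul_comm]
  · intro k _
    exact (integrable_signedSum_mul b σ (integrable_fourierProd _)).const_mul _

theorem integral_signedSum (hb1 : ∀ i, (b i).1.1.2 ≠ 0) :
    ∫ z, signedSum b σ z ∂(cubeMeasure.prod cubeMeasure) = 0 := by
  have h := integral_signedSum_mul_fourierProd b σ (FourierIndex.const, FourierIndex.const)
  simp only [fourierProd, fourierFun_const, mul_one] at h
  rw [h]
  refine Finset.sum_eq_zero fun i _ => ?_
  rw [if_neg, mul_zero]
  intro h
  exact hb1 i (by rw [h]; rfl)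

theorem integral_perturbedDensity (hb1 : ∀ i, (b i).1.1.2 ≠ 0) :
    ∫ z, perturbedDensity b δ σ z ∂(cubeMeasure.prod cubeMeasure) = 1 := by
  simp_rw [perturbedDensity]
  rw [integral_add (integrable_const _) ((integrable_signedSum b σ).const_mul δ),
    integral_const_mul, integral_signedSum σ hb1]
  simp

theorem integral_perturbedDensity_mul (hb : Function.Injective b)
    (hb1 : ∀ i, (b i).1.1.2 ≠ 0) :
    ∫ z, perturbedDensity b δ σ z * perturbedDensity b δ τ z ∂(cubeMeasure.prod cubeMeasure) =
      1 + δ ^ 2 * ∑ i, boolSign (σ i) * boolSign (τ i) := by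
  have h (z : Cube × Cube) : perturbedDensity b δ σ z * perturbedDensity b δ τ z =
      (perturbedDensity b δ σ z + δ * signedSum b τ z) +
        δ ^ 2 * (signedSum b σ z * signedSum b τ z) := by
    unfold perturbedDensity; ring
  have i1 : Integrable (perturbedDensity b δ σ) (cubeMeasure.prod cubeMeasure) :=
    (integrable_const _).add ((integrable_signedSum b σ).const_mul δ)
  have i2 := (integrable_signedSum b τ).const_mul δ
  have i3 : Integrable (fun z => perturbedDensity b δ σ z + δ * signedSum b τ z)
      (cubeMeasure.prod cubeMeasure) := i1.add i2
  simp_rw [h]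
  rw [integral_add i3
      ((integrable_signedSum_mul b σ (integrable_signedSum b τ)).const_mul _),
    integral_add i1 i2, integral_const_mul, integral_const_mul, integral_signedSum τ hb1,
    integral_signedSum_mul_signedSum σ τ hb, integral_perturbedDensity δ σ hb1]
  ring

theorem marginalX_perturbedDensity (hb2 : ∀ i, (b i).2.1.2 ≠ 0) :
    marginalX cubeMeasure (perturbedDensity b δ σ) = fun _ => 1 := by
  ext x
  have hi (i : ι) : Integrable (fun y => boolSign (σ i) * fourierProd (b i) (x, y))
      cubeMeasure :=
    Integrable.const_mul (Integrable.of_bound ((measurable_fourierProd _).comp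
      measurable_prodMk_left).aestronglyMeasurable _
      (Filter.Eventually.of_forall fun y => abs_fourierProd_le (b i) (x, y))) _
  simp_rw [marginalX, perturbedDensity, signedSum]
  rw [integral_add (integrable_const _) ((integrable_finsetSum _ fun i _ => hi i).const_mul δ),
    integral_const_mul, integral_finsetSum _ fun i _ => hi i]
  simp_rw [integral_const_mul, fourierProd, integral_const_mul, integral_fourierFun _ (hb2 _)]
  simp

theorem marginalY_perturbedDensity (hb1 : ∀ i, (b i).1.1.2 ≠ 0) :
    marginalY cubeMeasure (perturbedDensity b δ σ) = fun _ => 1 := by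
  ext y
  have hi (i : ι) : Integrable (fun x => boolSign (σ i) * fourierProd (b i) (x, y))
      cubeMeasure :=
    Integrable.const_mul (Integrable.of_bound ((measurable_fourierProd _).comp
      measurable_prodMk_right).aestronglyMeasurable _
      (Filter.Eventually.of_forall fun x => abs_fourierProd_le (b i) (x, y))) _
  simp_rw [marginalY, perturbedDensity, signedSum]
  rw [integral_add (integrable_const _) ((integrable_finsetSum _ fun i _ => hi i).const_mul δ),
    integral_const_mul, integral_finsetSum _ fun i _ => hi i]
  simp_rw [integral_const_mul, fourierProd, integral_mul_const, integral_fourierFun _ (hb1 _)]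
  simp

theorem dependence_perturbedDensity (hb : Function.Injective b)
    (hb1 : ∀ i, (b i).1.1.2 ≠ 0) (hb2 : ∀ i, (b i).2.1.2 ≠ 0) :
    dependence cubeMeasure cubeMeasure (perturbedDensity b δ σ) = δ ^ 2 * Fintype.card ι := by
  rw [dependence, marginalX_perturbedDensity δ σ hb2, marginalY_perturbedDensity δ σ hb1]
  have h (z : Cube × Cube) : (perturbedDensity b δ σ z - 1 * 1) ^ 2 =
      δ ^ 2 * (signedSum b σ z * signedSum b σ z) := by
    unfold perturbedDensity; ring
  simp_rw [h]
  rw [integral_const_mul, integral_signedSum_mul_signedSum σ σ hb]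
  simp [← sq, boolSign_sq]

/-- As the marginals are uniform for non-constant pairs, the first summand is then exactly a_{j∙}
a_{∙k}, so only the signed part enters the smoothness functional. -/
theorem coeff_perturbedDensity (j k : FourierIndex) :
    coeff cubeMeasure cubeMeasure fourierFun fourierFun (perturbedDensity b δ σ) j k =
      (∫ x, fourierFun j x ∂cubeMeasure) * (∫ y, fourierFun k y ∂cubeMeasure) +
        δ * ∑ i, boolSign (σ i) * if b i = (j, k) then 1 else 0 := by
  have h (z : Cube × Cube) : perturbedDensity b δ σ z * (fourierFun j z.1 * fourierFun k z.2) =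
      fourierFun j z.1 * fourierFun k z.2 + δ * (signedSum b σ z * fourierProd (j, k) z) := by
    unfold perturbedDensity fourierProd; ring
  have hi : Integrable (fun z : Cube × Cube => fourierFun j z.1 * fourierFun k z.2)
      (cubeMeasure.prod cubeMeasure) := integrable_fourierProd (j, k)
  simp_rw [coeff, h]
  rw [integral_add hi
    ((integrable_signedSum_mul b σ (integrable_fourierProd _)).const_mul _), integral_const_mul,
    integral_signedSum_mul_fourierProd, integral_prod_mul]

theorem smoothness_perturbedDensity (hb : Function.Injective b)
    (hb1 : ∀ i, (b i).1.1.2 ≠ 0) (hb2 : ∀ i, (b i).2.1.2 ≠ 0)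
    (θ : FourierIndex → FourierIndex → ℝ≥0∞) :
    smoothness cubeMeasure cubeMeasure fourierFun fourierFun θ (perturbedDensity b δ σ) =
      ∑ i, θ (b i).1 (b i).2 ^ 2 * ENNReal.ofReal (δ ^ 2) := by
  classical
  have hterm (p : FourierIndex × FourierIndex) : θ p.1 p.2 ^ 2 *
      ENNReal.ofReal ((coeff cubeMeasure cubeMeasure fourierFun fourierFun
          (perturbedDensity b δ σ) p.1 p.2 -
        coeffX cubeMeasure cubeMeasure fourierFun (perturbedDensity b δ σ) p.1 *
        coeffY cubeMeasure cubeMeasure fourierFun (perturbedDensity b δ σ) p.2) ^ 2) =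
      ∑ i, if p = b i then θ (b i).1 (b i).2 ^ 2 * ENNReal.ofReal (δ ^ 2) else 0 := by
    rw [coeff_perturbedDensity, coeffX, coeffY, marginalX_perturbedDensity δ σ hb2,
      marginalY_perturbedDensity δ σ hb1]
    simp only [one_mul, add_sub_cancel_left]
    by_cases hp : ∃ i, b i = p
    · obtain ⟨i, rfl⟩ := hp
      simp [hb.eq_iff, mul_pow, boolSign_sq]
    · push Not at hp
      rw [Finset.sum_eq_zero, Finset.sum_eq_zero]
      · simp
      · exact fun i _ => if_neg (hp i).symm
      · exact fun i _ => by rw [if_neg (hp i), mul_zero]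
  rw [smoothness, ← ENNReal.tsum_prod (f := fun j k => θ j k ^ 2 *
      ENNReal.ofReal ((coeff cubeMeasure cubeMeasure fourierFun fourierFun
          (perturbedDensity b δ σ) j k -
        coeffX cubeMeasure cubeMeasure fourierFun (perturbedDensity b δ σ) j *
        coeffY cubeMeasure cubeMeasure fourierFun (perturbedDensity b δ σ) k) ^ 2))]
  simp_rw [hterm]
  rw [Summable.tsum_finsetSum fun _ _ => ENNReal.summable]
  exact Finset.sum_congr rfl fun i _ => tsum_ite_eq _ _

theorem perturbedDensity_mem_alternatives (hb : Function.Injective b)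
    (hb1 : ∀ i, (b i).1.1.2 ≠ 0) (hb2 : ∀ i, (b i).2.1.2 ≠ 0)
    {θ : FourierIndex → FourierIndex → ℝ≥0∞} {r A ρ a : ℝ} (hA : 1 + a ≤ A) (ha : a ≤ 1)
    (hsup : ∀ z, |δ * signedSum b σ z| ≤ a) (hρ : ρ ^ 2 ≤ δ ^ 2 * Fintype.card ι)
    (hS : ∑ i, θ (b i).1 (b i).2 ^ 2 * ENNReal.ofReal (δ ^ 2) ≤ ENNReal.ofReal (r ^ 2)) :
    perturbedDensity b δ σ ∈
      alternatives cubeMeasure cubeMeasure fourierFun fourierFun θ r A ρ := by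
  have hnonneg (z : Cube × Cube) : 0 ≤ perturbedDensity b δ σ z := by
    have := (abs_le.1 (hsup z)).1
    unfold perturbedDensity
    linarith
  have hle (z : Cube × Cube) : perturbedDensity b δ σ z ≤ 1 + a := by
    have := (abs_le.1 (hsup z)).2
    unfold perturbedDensity
    linarith
  have ha0 : 0 ≤ a := (abs_nonneg _).trans (hsup (fun _ => 0, fun _ => 0))
  refine ⟨⟨measurable_perturbedDensity b δ σ, ?_, Filter.Eventually.of_forall hnonneg,
    integral_perturbedDensity δ σ hb1⟩, ?_, ?_, ?_⟩
  · refine MemLp.of_bound (measurable_perturbedDensity b δ σ).aestronglyMeasurable (1 + a)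
      (Filter.Eventually.of_forall fun z => ?_)
    rw [Real.norm_eq_abs, abs_of_nonneg (hnonneg z)]
    exact hle z
  · rwa [dependence_perturbedDensity δ σ hb hb1 hb2]
  · rwa [smoothness_perturbedDensity δ σ hb hb1 hb2]
  · rw [marginalX_perturbedDensity δ σ hb2, marginalY_perturbedDensity δ σ hb1]
    have h1 : supNorm (fun _ : Cube => (1 : ℝ)) ≤ ENNReal.ofReal A :=
      iSup_le fun _ => ENNReal.ofReal_le_ofReal (by rw [abs_one]; linarith)
    refine max_le (iSup_le fun z => ENNReal.ofReal_le_ofReal ?_) (max_le h1 h1)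
    rw [abs_of_nonneg (hnonneg z)]
    exact (hle z).trans hA

end Perturbation

/-! ### Product likelihoods and Le Cam's second-moment bound -/

section Mixture

variable {Z : Type*} [MeasurableSpace Z]

/-- A product measure is determined by its values on boxes, where the indicator of the box
factorises and independence splits the integral. -/
theorem pi_withDensity_eq {κ : Type*} [Fintype κ] (P : Measure Z) [IsProbabilityMeasure P]
    {g : Z → ℝ≥0∞} (hg : Measurable g) [IsProbabilityMeasure (P.withDensity g)] :
    Measure.pi (fun _ : κ => P.withDensity g) =
      (Measure.pi fun _ : κ => P).withDensity fun w => ∏ i, g (w i) := by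
  refine Measure.pi_eq fun s hs => ?_
  rw [withDensity_apply _ (MeasurableSet.univ_pi hs), ← lintegral_indicator
    (MeasurableSet.univ_pi hs)]
  have h (w : κ → Z) : (Set.univ.pi s).indicator (fun w => ∏ i, g (w i)) w =
      ∏ i, (s i).indicator g (w i) := by
    by_cases hw : w ∈ Set.univ.pi s
    · rw [Set.indicator_of_mem hw]
      exact Finset.prod_congr rfl fun i _ =>
        (Set.indicator_of_mem (hw i (Set.mem_univ i)) g).symm
    · rw [Set.indicator_of_notMem hw]
      simp only [Set.mem_univ_pi, not_forall] at hw
      obtain ⟨i, hi⟩ := hw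
      exact (Finset.prod_eq_zero (Finset.mem_univ i) (Set.indicator_of_notMem hi g)).symm
  have hm (i : κ) : Measurable ((s i).indicator g) := hg.indicator (hs i)
  simp_rw [h]
  rw [lintegral_prod_eq_prod_lintegral_of_indepFun Finset.univ
    (fun (i : κ) (w : κ → Z) => (s i).indicator g (w i))
    (iIndepFun_pi fun i => (hm i).aemeasurable) fun i => (hm i).comp (measurable_pi_apply i)]
  refine Finset.prod_congr rfl fun i _ => ?_
  rw [(measurePreserving_eval (fun _ : κ => P) i).lintegral_comp (hm i),
    lintegral_indicator (hs i), withDensity_apply _ (hs i)]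

theorem isProbabilityMeasure_withDensity_ofReal (P : Measure Z) {f : Z → ℝ}
    (hf : Integrable f P) (h0 : ∀ z, 0 ≤ f z) (h1 : ∫ z, f z ∂P = 1) :
    IsProbabilityMeasure (P.withDensity fun z => ENNReal.ofReal (f z)) := by
  constructor
  rw [withDensity_apply _ MeasurableSet.univ, Measure.restrict_univ,
    ← ofReal_integral_eq_lintegral_ofReal hf (Filter.Eventually.of_forall h0), h1,
    ENNReal.ofReal_one]

theorem integral_pi_withDensity {κ : Type*} [Fintype κ] (P : Measure Z)
    [IsProbabilityMeasure P] {f : Z → ℝ} (hm : Measurable f)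
    (hf : Integrable f P) (h0 : ∀ z, 0 ≤ f z) (h1 : ∫ z, f z ∂P = 1) (W : (κ → Z) → ℝ) :
    ∫ w, W w ∂(Measure.pi fun _ : κ => P.withDensity fun z => ENNReal.ofReal (f z)) =
      ∫ w, (∏ i, f (w i)) * W w ∂(Measure.pi fun _ : κ => P) := by
  have := isProbabilityMeasure_withDensity_ofReal P hf h0 h1
  have h (w : κ → Z) : ∏ i, ENNReal.ofReal (f (w i)) = ENNReal.ofReal (∏ i, f (w i)) :=
    (ENNReal.ofReal_prod_of_nonneg fun i _ => h0 _).symm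
  rw [pi_withDensity_eq P hm.ennreal_ofReal]
  simp_rw [h]
  rw [integral_withDensity_eq_integral_toReal_smul (by fun_prop)
    (Filter.Eventually.of_forall fun _ => ENNReal.ofReal_lt_top)]
  simp_rw [ENNReal.toReal_ofReal (Finset.prod_nonneg fun i _ => h0 _), smul_eq_mul]

/-- Le Cam's bound: a mixture of product likelihoods whose second moment is at most `1 + η²`
cannot be distinguished from the base measure with power exceeding the size by more than `η`. -/
theorem exists_type_two_error_ge {κ I : Type*} [Fintype κ] (P : Measure Z)
    [IsProbabilityMeasure P] (S : Finset I) (hS : S.Nonempty) {f : I → Z → ℝ} {M : ℝ}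
    (hm : ∀ σ ∈ S, Measurable (f σ)) (h0 : ∀ σ ∈ S, ∀ z, 0 ≤ f σ z)
    (hM : ∀ σ ∈ S, ∀ z, f σ z ≤ M) (h1 : ∀ σ ∈ S, ∫ z, f σ z ∂P = 1) {η : ℝ} (hη : 0 < η)
    (hchi : ∑ σ ∈ S, ∑ τ ∈ S, (∫ z, f σ z * f τ z ∂P) ^ Fintype.card κ ≤
      (1 + η ^ 2) * (S.card : ℝ) ^ 2)
    {ψ : (κ → Z) → ℝ} (hψ : Measurable ψ) (hψ01 : ∀ w, ψ w ∈ Set.Icc (0 : ℝ) 1) :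
    ∃ σ ∈ S, 1 - ∫ w, ψ w ∂(Measure.pi fun _ : κ => P) - η ≤
      ∫ w, (1 - ψ w) ∂(Measure.pi fun _ : κ => P.withDensity fun z => ENNReal.ofReal (f σ z)) := by
  set ν := Measure.pi fun _ : κ => P with hν
  set N : ℝ := (S.card : ℝ) with hN
  have hNpos : 0 < N := Nat.cast_pos.2 hS.card_pos
  set L : I → (κ → Z) → ℝ := fun σ w => ∏ i, f σ (w i) with hL
  have hLm (σ) (hσ : σ ∈ S) : Measurable (L σ) := by
    have := hm σ hσ
    simp only [hL]
    fun_prop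
  have hL0 (σ) (hσ : σ ∈ S) (w) : 0 ≤ L σ w := Finset.prod_nonneg fun i _ => h0 σ hσ _
  have hLM (σ) (hσ : σ ∈ S) (w) : L σ w ≤ M ^ Fintype.card κ :=
    (Finset.prod_le_prod (fun i _ => h0 σ hσ _) fun i _ => hM σ hσ _).trans_eq (by simp)
  have hbd (σ) (hσ : σ ∈ S) : Integrable (f σ) P :=
    Integrable.of_bound (hm σ hσ).aestronglyMeasurable M (Filter.Eventually.of_forall fun z => by
      rw [Real.norm_eq_abs, abs_of_nonneg (h0 σ hσ z)]; exact hM σ hσ z)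
  have hLi (σ) (hσ : σ ∈ S) : Integrable (L σ) ν :=
    Integrable.of_bound (hLm σ hσ).aestronglyMeasurable (M ^ Fintype.card κ)
      (Filter.Eventually.of_forall fun w => by
        rw [Real.norm_eq_abs, abs_of_nonneg (hL0 σ hσ w)]; exact hLM σ hσ w)
  have hLL (σ) (hσ : σ ∈ S) (τ) (hτ : τ ∈ S) : Integrable (fun w => L σ w * L τ w) ν :=
    (hLi τ hτ).bdd_mul (hLm σ hσ).aestronglyMeasurable
      (Filter.Eventually.of_forall fun w => by
        rw [Real.norm_eq_abs, abs_of_nonneg (hL0 σ hσ w)]; exact hLM σ hσ w)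
  have hL1 (σ) (hσ : σ ∈ S) : ∫ w, L σ w ∂ν = 1 := by
    rw [hν, hL, integral_fintype_prod_eq_pow, h1 σ hσ, one_pow]
  have hL2 (σ τ) : ∫ w, L σ w * L τ w ∂ν = (∫ z, f σ z * f τ z ∂P) ^ Fintype.card κ := by
    simp only [hL, ← Finset.prod_mul_distrib]
    rw [hν, integral_fintype_prod_eq_pow fun z => f σ z * f τ z]
  have hψi : Integrable ψ ν := Integrable.of_bound hψ.aestronglyMeasurable 1
    (Filter.Eventually.of_forall fun w => by
      rw [Real.norm_eq_abs, abs_of_nonneg (hψ01 w).1]; exact (hψ01 w).2)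
  have hψL (σ) (hσ : σ ∈ S) : Integrable (fun w => ψ w * L σ w) ν :=
    (hLi σ hσ).bdd_mul hψ.aestronglyMeasurable (Filter.Eventually.of_forall fun w => by
      rw [Real.norm_eq_abs, abs_of_nonneg (hψ01 w).1]; exact (hψ01 w).2)
  set B : (κ → Z) → ℝ := fun w => (∑ σ ∈ S, L σ w) / N with hB
  have hBi : Integrable B ν := (integrable_finsetSum S fun σ hσ => hLi σ hσ).div_const N
  have hB1 : ∫ w, B w ∂ν = 1 := by
    simp only [hB]
    rw [integral_div, integral_finsetSum S fun σ hσ => hLi σ hσ, Finset.sum_congr rfl hL1]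
    rw [Finset.sum_const, nsmul_one, div_self hNpos.ne']
  have hBB (w) : B w ^ 2 = (∑ σ ∈ S, ∑ τ ∈ S, L σ w * L τ w) / N ^ 2 := by
    rw [hB, div_pow, sq (∑ σ ∈ S, L σ w), Finset.sum_mul_sum]
  have hBBi : Integrable (fun w => B w ^ 2) ν := by
    simp_rw [hBB]
    exact (integrable_finsetSum S fun σ hσ => integrable_finsetSum S fun τ hτ =>
      hLL σ hσ τ hτ).div_const _
  have hB2 : ∫ w, B w ^ 2 ∂ν ≤ 1 + η ^ 2 := by
    simp_rw [hBB]
    rw [integral_div, integral_finsetSum S fun σ hσ => integrable_finsetSum S fun τ hτ =>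
      hLL σ hσ τ hτ, div_le_iff₀ (by positivity)]
    refine le_of_eq_of_le (Finset.sum_congr rfl fun σ hσ => ?_) hchi
    rw [integral_finsetSum S fun τ hτ => hLL σ hσ τ hτ]
    exact Finset.sum_congr rfl fun τ _ => hL2 σ τ
  have hψB : ∫ w, ψ w * B w ∂ν = (∑ σ ∈ S, ∫ w, ψ w * L σ w ∂ν) / N := by
    have h (w) : ψ w * B w = (∑ σ ∈ S, ψ w * L σ w) / N := by
      rw [hB, ← mul_div_assoc, Finset.mul_sum]
    simp_rw [h]
    rw [integral_div, integral_finsetSum S fun σ hσ => hψL σ hσ]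
  have hψBi : Integrable (fun w => ψ w * B w) ν :=
    hBi.bdd_mul hψ.aestronglyMeasurable (Filter.Eventually.of_forall fun w => by
      rw [Real.norm_eq_abs, abs_of_nonneg (hψ01 w).1]; exact (hψ01 w).2)
  have hmain : ∫ w, ψ w * B w ∂ν ≤ ∫ w, ψ w ∂ν + η := by
    -- The inequality ψ(B - 1) ≤ |B - 1| ≤ ((B - 1)² + η²)/(2η) is kept in expanded form:
    -- integrating needs only ∫B = 1 and ∫B² ≤ 1 + η², and the error is then at most η.
    have hpt (w) : ψ w * B w ≤
        ψ w + (B w ^ 2 * (1 / (2 * η)) - B w * (1 / η) + (1 / (2 * η) + η / 2)) := by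
      have e : B w ^ 2 * (1 / (2 * η)) - B w * (1 / η) + (1 / (2 * η) + η / 2) =
          ((B w - 1) ^ 2 + η ^ 2) / (2 * η) := by field_simp; ring
      have h2 : |B w - 1| ≤ ((B w - 1) ^ 2 + η ^ 2) / (2 * η) := by
        rw [le_div_iff₀ (by positivity), ← sq_abs]
        nlinarith [sq_nonneg (|B w - 1| - η)]
      have h3 : ψ w * (B w - 1) ≤ |B w - 1| := by
        calc ψ w * (B w - 1) ≤ |ψ w * (B w - 1)| := le_abs_self _
          _ = ψ w * |B w - 1| := by rw [abs_mul, abs_of_nonneg (hψ01 w).1]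
          _ ≤ 1 * |B w - 1| := mul_le_mul_of_nonneg_right (hψ01 w).2 (abs_nonneg _)
          _ = _ := one_mul _
      rw [e]
      linarith
    have i1 : Integrable (fun w => B w ^ 2 * (1 / (2 * η)) - B w * (1 / η)) ν :=
      (hBBi.mul_const _).sub (hBi.mul_const _)
    have i2 : Integrable (fun w => B w ^ 2 * (1 / (2 * η)) - B w * (1 / η) +
        (1 / (2 * η) + η / 2)) ν := i1.add (integrable_const _)
    refine (integral_mono hψBi (hψi.add i2) hpt).trans ?_
    simp only [Pi.add_apply]
    rw [integral_add hψi i2, integral_add i1 (integrable_const _),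
      integral_sub (hBBi.mul_const _) (hBi.mul_const _), integral_mul_const, integral_mul_const,
      hB1]
    simp only [integral_const, probReal_univ, smul_eq_mul, one_mul]
    have h4 : (∫ w, B w ^ 2 ∂ν) * (1 / (2 * η)) ≤ (1 + η ^ 2) * (1 / (2 * η)) := by gcongr
    have h5 : (1 + η ^ 2) * (1 / (2 * η)) - 1 / η + (1 / (2 * η) + η / 2) = η := by
      field_simp; ring
    linarith
  -- Some member of the mixture has power no larger than the average power.
  obtain ⟨σ, hσ, hle⟩ : ∃ σ ∈ S, ∫ w, ψ w * L σ w ∂ν ≤ ∫ w, ψ w ∂ν + η := by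
    by_contra! hcon
    have := Finset.sum_lt_sum_of_nonempty hS hcon
    rw [hψB, div_le_iff₀ hNpos] at hmain
    simp only [Finset.sum_const, nsmul_eq_mul] at this
    rw [mul_comm] at this
    linarith
  refine ⟨σ, hσ, ?_⟩
  rw [integral_pi_withDensity P (hm σ hσ) (hbd σ hσ) (h0 σ hσ) (h1 σ hσ)]
  have e (w : κ → Z) : (∏ i, f σ (w i)) * (1 - ψ w) = L σ w - ψ w * L σ w := by
    simp only [hL]; ring
  simp_rw [e]
  rw [integral_sub (hLi σ hσ) (hψL σ hσ), hL1 σ hσ]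
  linarith

end Mixture

/-! ### From indistinguishability to the separation radius -/

section Reduction

variable {X Y J K : Type*} [MeasurableSpace X] [MeasurableSpace Y]

theorem sampleExpectation_mem_Icc {P : Measure (X × Y)} [IsProbabilityMeasure P] {n : ℕ}
    {W : (Fin n → X × Y) → ℝ} (hW : ∀ w, W w ∈ Set.Icc (0 : ℝ) 1) :
    sampleExpectation P n W ∈ Set.Icc (0 : ℝ) 1 := by
  refine ⟨integral_nonneg fun w => (hW w).1, ?_⟩
  by_cases hi : Integrable W (Measure.pi fun _ : Fin n => P)
  · refine (integral_mono hi (integrable_const 1) fun w => (hW w).2).trans_eq ?_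
    simp
  -- A non-integrable function has integral 0 by convention, which still lies in the interval.
  · rw [sampleExpectation, integral_undef hi]
    exact zero_le_one

theorem prod_mem_nullLaws (μX : Measure X) (μY : Measure Y) [IsProbabilityMeasure μX]
    [IsProbabilityMeasure μY] : μX.prod μY ∈ nullLaws X Y := by
  refine ⟨inferInstance, ?_⟩
  exact indepFun_prod (μ := μX) (ν := μY) measurable_id measurable_id

theorem zero_mem_validTests {n : ℕ} {α : ℝ} (hα : 0 ≤ α) :
    (fun _ => 0) ∈ validTests X Y n α :=
  ⟨⟨measurable_const, fun _ => ⟨le_rfl, zero_le_one⟩⟩, fun P _ => by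
    simpa [sampleExpectation] using hα⟩

theorem isProbabilityMeasure_lawOfDensity {μX : Measure X} {μY : Measure Y}
    [IsProbabilityMeasure μX] [IsProbabilityMeasure μY] {f : X × Y → ℝ}
    (hf : f ∈ densities μX μY) : IsProbabilityMeasure (lawOfDensity μX μY f) := by
  constructor
  rw [lawOfDensity, withDensity_apply _ MeasurableSet.univ, Measure.restrict_univ,
    ← ofReal_integral_eq_lintegral_ofReal (hf.2.1.integrable one_le_two) hf.2.2.1, hf.2.2.2,
    ENNReal.ofReal_one]

theorem le_worstTypeII {μX : Measure X} {μY : Measure Y}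
    [IsProbabilityMeasure μX] [IsProbabilityMeasure μY] {n : ℕ} {F : Set (X × Y → ℝ)}
    (hF : F ⊆ densities μX μY) {ψ : (Fin n → X × Y) → ℝ} (hψ : ψ ∈ randomisedTests X Y n)
    {f : X × Y → ℝ} (hf : f ∈ F) :
    sampleExpectation (lawOfDensity μX μY f) n (fun w => 1 - ψ w) ≤ worstTypeII μX μY n F ψ := by
  refine le_csSup ⟨1, ?_⟩ ⟨f, hf, rfl⟩
  rintro _ ⟨g, hg, rfl⟩
  have := isProbabilityMeasure_lawOfDensity (hF hg)
  exact (sampleExpectation_mem_Icc fun w =>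
    ⟨by linarith [(hψ.2 w).2], by linarith [(hψ.2 w).1]⟩).2

theorem le_testingRisk (μX : Measure X) (μY : Measure Y) [IsProbabilityMeasure μX]
    [IsProbabilityMeasure μY] {pX : J → X → ℝ} {pY : K → Y → ℝ} {n : ℕ} {α : ℝ} (hα : 0 ≤ α)
    {θ : J → K → ℝ≥0∞} {r A ρ : ℝ} {I : Type*} (S : Finset I) (hS : S.Nonempty)
    {f : I → X × Y → ℝ} (hmem : ∀ σ ∈ S, f σ ∈ alternatives μX μY pX pY θ r A ρ)
    (h0 : ∀ σ ∈ S, ∀ z, 0 ≤ f σ z) (hM : ∀ σ ∈ S, ∀ z, f σ z ≤ A) {η : ℝ} (hη : 0 < η)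
    (hchi : ∑ σ ∈ S, ∑ τ ∈ S, (∫ z, f σ z * f τ z ∂(μX.prod μY)) ^ n ≤
      (1 + η ^ 2) * (S.card : ℝ) ^ 2) :
    1 - η ≤ testingRisk μX μY pX pY n α θ r A ρ := by
  suffices h : 1 - α - η ≤
      sInf (worstTypeII μX μY n (alternatives μX μY pX pY θ r A ρ) '' validTests X Y n α) by
    unfold testingRisk
    linarith
  refine le_csInf (Set.Nonempty.image _ ⟨_, zero_mem_validTests hα⟩) ?_
  rintro _ ⟨ψ, hψ, rfl⟩
  obtain ⟨σ, hσ, hle⟩ := exists_type_two_error_ge (κ := Fin n) (μX.prod μY) S hS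
    (fun σ hσ => (hmem σ hσ).1.1) h0 hM (fun σ hσ => (hmem σ hσ).1.2.2.2) hη
    (by simpa using hchi) hψ.1.1 hψ.1.2
  have h1 := hψ.2 _ (prod_mem_nullLaws μX μY)
  have h2 := le_worstTypeII (fun f hf => hf.1) hψ.1 (hmem σ hσ)
  unfold sampleExpectation at h1 h2
  unfold lawOfDensity at h2
  linarith

theorem alternatives_anti (μX : Measure X) (μY : Measure Y) (pX : J → X → ℝ) (pY : K → Y → ℝ)
    (θ : J → K → ℝ≥0∞) (r A : ℝ) {ρ ρ' : ℝ} (h0 : 0 ≤ ρ) (h : ρ ≤ ρ') :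
    alternatives μX μY pX pY θ r A ρ' ⊆ alternatives μX μY pX pY θ r A ρ :=
  fun _ hf => ⟨hf.1, (pow_le_pow_left₀ h0 h 2).trans hf.2.1, hf.2.2⟩

theorem abs_le_of_supNorm_le {Z : Type*} {g : Z → ℝ} {A : ℝ} (hA : 0 ≤ A)
    (h : supNorm g ≤ ENNReal.ofReal A) (z : Z) : |g z| ≤ A :=
  (ENNReal.ofReal_le_ofReal_iff hA).1
    ((le_iSup (fun z => ENNReal.ofReal |g z|) z).trans h)

theorem dependence_le_of_mem_alternatives {μX : Measure X} {μY : Measure Y}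
    [IsProbabilityMeasure μX] [IsProbabilityMeasure μY] {pX : J → X → ℝ} {pY : K → Y → ℝ}
    {θ : J → K → ℝ≥0∞} {r A ρ : ℝ} (hA : 0 ≤ A) {f : X × Y → ℝ}
    (hf : f ∈ alternatives μX μY pX pY θ r A ρ) : dependence μX μY f ≤ (A + A * A) ^ 2 := by
  obtain ⟨-, -, -, hsup⟩ := hf
  have h1 := abs_le_of_supNorm_le hA ((le_max_left _ _).trans hsup)
  have h2 := abs_le_of_supNorm_le hA
    ((le_max_left _ _).trans ((le_max_right _ _).trans hsup))
  have h3 := abs_le_of_supNorm_le hA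
    ((le_max_right _ _).trans ((le_max_right _ _).trans hsup))
  have h := norm_integral_le_of_norm_le_const (μ := μX.prod μY) (C := (A + A * A) ^ 2)
    (f := fun z => (f z - marginalX μY f z.1 * marginalY μX f z.2) ^ 2)
    (Filter.Eventually.of_forall fun z => by
      rw [norm_pow, Real.norm_eq_abs]
      refine pow_le_pow_left₀ (abs_nonneg _) ((abs_sub _ _).trans (add_le_add (h1 z) ?_)) 2
      rw [abs_mul]
      exact mul_le_mul (h2 _) (h3 _) (abs_nonneg _) hA)
  rw [probReal_univ, mul_one] at h
  exact (le_abs_self _).trans h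

/-- The infimum of an empty set of reals is 0, so a lower bound on the radius requires some
admissible ρ to exist. Beyond the largest dependence compatible with the sup-norm bounds the class
is empty and the risk is α. -/
theorem exists_testingRisk_le (μX : Measure X) (μY : Measure Y) [IsProbabilityMeasure μX]
    [IsProbabilityMeasure μY] (pX : J → X → ℝ) (pY : K → Y → ℝ) (n : ℕ) {α β : ℝ} (hα : 0 ≤ α)
    (hβ : 0 ≤ β) (θ : J → K → ℝ≥0∞) (r : ℝ) {A : ℝ} (hA : 0 ≤ A) :
    ∃ ρ : ℝ, 0 < ρ ∧ testingRisk μX μY pX pY n α θ r A ρ ≤ α + β := by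
  refine ⟨A + A * A + 1, by positivity, ?_⟩
  have hempty : alternatives μX μY pX pY θ r A (A + A * A + 1) = ∅ := by
    refine Set.eq_empty_of_forall_notMem fun f hf => ?_
    have h1 := dependence_le_of_mem_alternatives hA hf
    have h2 := hf.2.1
    nlinarith [mul_nonneg hA hA]
  have hne : (validTests X Y n α).Nonempty := ⟨_, zero_mem_validTests hα⟩
  have h0 : worstTypeII μX μY n (∅ : Set (X × Y → ℝ)) = fun _ => 0 := by
    ext ψ
    simp [worstTypeII]
  rw [testingRisk, hempty, h0, hne.image_const, csInf_singleton]
  linarith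

/-- Classes grow as ρ decreases, so the same family shows that the risk is at least 1 - η > α + β at
every smaller positive radius. -/
theorem le_separationRadius (μX : Measure X) (μY : Measure Y) [IsProbabilityMeasure μX]
    [IsProbabilityMeasure μY] {pX : J → X → ℝ} {pY : K → Y → ℝ} {n : ℕ} {α β : ℝ} (hα : 0 ≤ α)
    (hβ : 0 ≤ β) {θ : J → K → ℝ≥0∞} {r A ρ : ℝ} (hA : 0 ≤ A) {I : Type*} (S : Finset I)
    (hS : S.Nonempty) {f : I → X × Y → ℝ}
    (hmem : ∀ σ ∈ S, f σ ∈ alternatives μX μY pX pY θ r A ρ)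
    (h0 : ∀ σ ∈ S, ∀ z, 0 ≤ f σ z) {η : ℝ} (hη : 0 < η)
    (hαβ : α + β < 1 - η)
    (hchi : ∑ σ ∈ S, ∑ τ ∈ S, (∫ z, f σ z * f τ z ∂(μX.prod μY)) ^ n ≤
      (1 + η ^ 2) * (S.card : ℝ) ^ 2) :
    ρ ≤ separationRadius μX μY pX pY n α β θ r A := by
  refine le_csInf (exists_testingRisk_le μX μY pX pY n hα hβ θ r hA) fun ρ' hρ' => ?_
  by_contra! hlt
  have h := le_testingRisk μX μY hα S hS
    (fun σ hσ => alternatives_anti μX μY pX pY θ r A hρ'.1.le hlt.le (hmem σ hσ)) h0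
    (fun σ hσ z => (le_abs_self _).trans
      (abs_le_of_supNorm_le hA ((le_max_left _ _).trans (hmem σ hσ).2.2.2) z)) hη hchi
  linarith [hρ'.2]

end Reduction

/-! ### The radius bound for a given family of index pairs -/

section Radius

theorem sum_sum_integral_pow_le {ι : Type*} [Fintype ι] [DecidableEq ι]
    {b : ι → FourierIndex × FourierIndex}
    (hb : Function.Injective b) (hb1 : ∀ i, (b i).1.1.2 ≠ 0) {δ : ℝ} (n : ℕ)
    (S : Finset (ι → Bool)) (h0 : ∀ σ ∈ S, ∀ z, 0 ≤ perturbedDensity b δ σ z) :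
    ∑ σ ∈ S, ∑ τ ∈ S, (∫ z, perturbedDensity b δ σ z * perturbedDensity b δ τ z
      ∂(cubeMeasure.prod cubeMeasure)) ^ n ≤
      (2 ^ Fintype.card ι) ^ 2 * Real.exp (Fintype.card ι * (n * δ ^ 2) ^ 2 / 2) := by
  refine le_trans ?_ (sum_sum_exp_boolSign_le (n * δ ^ 2))
  -- Passing to exponentials makes every term positive, so the sums over `S` may be enlarged to all
  -- sign vectors.
  refine (Finset.sum_le_sum fun σ hσ => ?_).trans
    (Finset.sum_le_sum_of_subset_of_nonneg S.subset_univ fun σ _ _ =>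
      Finset.sum_nonneg fun τ _ => (Real.exp_pos _).le)
  refine (Finset.sum_le_sum fun τ hτ => ?_).trans
    (Finset.sum_le_sum_of_subset_of_nonneg S.subset_univ fun τ _ _ => (Real.exp_pos _).le)
  have hnn : 0 ≤ ∫ z, perturbedDensity b δ σ z * perturbedDensity b δ τ z
      ∂(cubeMeasure.prod cubeMeasure) :=
    integral_nonneg fun z => mul_nonneg (h0 σ hσ z) (h0 τ hτ z)
  refine (pow_le_pow_left₀ hnn ?_ n).trans_eq (?_ : Real.exp
    (δ ^ 2 * ∑ i, boolSign (σ i) * boolSign (τ i)) ^ n = _)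
  · rw [integral_perturbedDensity_mul δ σ τ hb hb1, add_comm]
    exact Real.add_one_le_exp _
  · rw [← Real.exp_nat_mul]
    congr 1
    ring

/-- The mixture is uniform over the signs whose perturbation stays within `a` everywhere. By `hbad`
these form a proportion at least `q` of all 2^m, and the factor q² in `hchi` pays for normalising by
their number. -/
theorem le_cubeRadius_of_family {m : ℕ} (hm : 1 ≤ m)
    {b : Fin m → FourierIndex × FourierIndex} (hb : Function.Injective b)
    (hb1 : ∀ i, (b i).1.1.2 ≠ 0) (hb2 : ∀ i, (b i).2.1.2 ≠ 0) {T G : ℕ} (hG : 0 < G)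
    (hT : ∀ i, (b i).1.size ≤ T ∧ (b i).2.size ≤ T) {n : ℕ}
    {α β sX sY r A ρ δ a η q W : ℝ} (hα : 0 ≤ α) (hβ : 0 ≤ β) (hδ : 0 < δ) (ha : 0 < a)
    (ha1 : a ≤ 1) (hA : 1 + a ≤ A) (hη : 0 < η) (hαβ : α + β < 1 - η) (hq : 0 < q)
    (hW : ∀ i, expWeight sX sY (b i).1 (b i).2 ^ 2 ≤ ENNReal.ofReal W) (hW0 : 0 ≤ W)
    (hr : m * (W * δ ^ 2) ≤ r ^ 2) (hρ : ρ ^ 2 ≤ δ ^ 2 * m)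
    (hnet : m * (8 * Real.pi * (T ^ 2 * (1 / G))) ≤ a / δ / 2)
    (hbad : ((G : ℝ) + 1) ^ (2 * T) * (2 * Real.exp (-((a / δ) ^ 2 / (32 * m)))) ≤ 1 - q)
    (hchi : Real.exp (m * (n * δ ^ 2) ^ 2 / 2) ≤ (1 + η ^ 2) * q ^ 2) :
    ρ ≤ cubeRadius n α β sX sY r A := by
  classical
  have : Nonempty (Fin m) := ⟨⟨0, hm⟩⟩
  set S : Finset (Fin m → Bool) := Finset.univ.filter fun σ => ∀ z, |signedSum b σ z| ≤ a / δ
    with hSdef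
  have hS (σ) (hσ : σ ∈ S) (z) : |δ * signedSum b σ z| ≤ a := by
    rw [abs_mul, abs_of_pos hδ, mul_comm, ← le_div_iff₀ hδ]
    exact (Finset.mem_filter.1 hσ).2 z
  have h0 (σ) (hσ : σ ∈ S) (z) : 0 ≤ perturbedDensity b δ σ z := by
    have := (abs_le.1 (hS σ hσ z)).1
    unfold perturbedDensity
    linarith
  have hcard : q * 2 ^ m ≤ (S.card : ℝ) := by
    have h1 := card_exists_lt_abs_sum_fourierProd_le b hG hT (u := a / δ) (by positivity)
      (by simpa using hnet)
    rw [Nat.card_eq_fintype_card, Fintype.card_subtype, Fintype.card_fin] at h1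
    have h2 : (Finset.univ.filter fun σ : Fin m → Bool =>
        ∃ z, a / δ < |∑ i, boolSign (σ i) * fourierProd (b i) z|) =
        Finset.univ.filter fun σ => ¬ ∀ z, |signedSum b σ z| ≤ a / δ := by
      refine Finset.filter_congr fun σ _ => ?_
      push Not
      rfl
    rw [h2] at h1
    have h3 : (S.card : ℝ) + ((Finset.univ.filter fun σ : Fin m → Bool =>
        ¬ ∀ z, |signedSum b σ z| ≤ a / δ).card : ℝ) = 2 ^ m := by
      rw [hSdef, ← Nat.cast_add, Finset.card_filter_add_card_filter_not]
      simp
    have h4 := mul_le_mul_of_nonneg_right hbad (by positivity : (0 : ℝ) ≤ 2 ^ m)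
    linarith
  have hqm : 0 < q * 2 ^ m := by positivity
  have hSne : S.Nonempty := Finset.card_pos.1 (by exact_mod_cast hqm.trans_le hcard)
  refine le_separationRadius cubeMeasure cubeMeasure hα hβ (by linarith) S hSne
    (fun σ hσ => perturbedDensity_mem_alternatives δ σ hb hb1 hb2 hA ha1 (hS σ hσ)
      (by simpa using hρ) ?_) h0 hη hαβ ?_
  · refine (Finset.sum_le_sum fun i _ => mul_le_mul_left (hW i) _).trans ?_
    rw [Finset.sum_const, Finset.card_univ, Fintype.card_fin, nsmul_eq_mul,
      ← ENNReal.ofReal_mul hW0, ← ENNReal.ofReal_natCast, ← ENNReal.ofReal_mul (by positivity)]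
    exact ENNReal.ofReal_le_ofReal hr
  · refine (sum_sum_integral_pow_le hb hb1 n S h0).trans ?_
    rw [Fintype.card_fin]
    calc _ ≤ ((2 : ℝ) ^ m) ^ 2 * ((1 + η ^ 2) * q ^ 2) := by gcongr
      _ = (1 + η ^ 2) * (q * 2 ^ m) ^ 2 := by ring
      _ ≤ _ := by gcongr

end Radius

/-! ### Counting Fourier indices of bounded size -/

section Counting

theorem floor_div_sq_eq_zero {t : ℝ} {l : ℕ} (hl : ⌊t⌋₊ ≤ l) :
    ⌊t / ((l : ℝ) + 1) ^ 2⌋₊ = 0 := by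
  rw [Nat.floor_eq_zero, div_lt_one (by positivity)]
  have h1 := Nat.lt_floor_add_one t
  have h2 : (⌊t⌋₊ : ℝ) ≤ l := by exact_mod_cast hl
  nlinarith [Nat.cast_nonneg (α := ℝ) l]

theorem tsum_log_floor_eq_sum (t : ℝ) :
    ∑' l : ℕ, Real.log (1 + (⌊t / ((l : ℝ) + 1) ^ 2⌋₊ : ℝ)) =
      ∑ l ∈ Finset.range ⌊t⌋₊, Real.log (1 + (⌊t / ((l : ℝ) + 1) ^ 2⌋₊ : ℝ)) := by
  refine tsum_eq_sum fun l hl => ?_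
  rw [floor_div_sq_eq_zero (by simpa using hl)]
  simp

theorem countM_eq_prod (t : ℝ) :
    countM t = ((∏ l ∈ Finset.range ⌊t⌋₊, (⌊t / ((l : ℝ) + 1) ^ 2⌋₊ + 1) : ℕ) : ℝ) - 1 := by
  rw [countM, tsum_log_floor_eq_sum, Real.exp_sum]
  push_cast
  congr 1
  refine Finset.prod_congr rfl fun l _ => ?_
  rw [Real.exp_log (by positivity), add_comm]

theorem countM_nonneg (t : ℝ) : 0 ≤ countM t := by
  rw [countM_eq_prod, sub_nonneg]
  exact_mod_cast Finset.prod_pos fun l _ => Nat.succ_pos _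

theorem countM_eq_zero {t : ℝ} (ht : t < 1) : countM t = 0 := by
  rw [countM_eq_prod, Nat.floor_eq_zero.2 ht]
  simp

theorem one_le_countM {t : ℝ} (ht : 1 ≤ t) : 1 ≤ countM t := by
  have h1 : 1 ≤ ⌊t⌋₊ := Nat.one_le_floor_iff t |>.2 ht
  have h2 : 2 ≤ ∏ l ∈ Finset.range ⌊t⌋₊, (⌊t / ((l : ℝ) + 1) ^ 2⌋₊ + 1) := by
    refine le_trans ?_ (Finset.single_le_prod' (fun l _ => Nat.succ_pos _)
      (Finset.mem_range.2 h1))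
    simpa using h1
  rw [countM_eq_prod, le_sub_iff_add_le]
  norm_num
  exact_mod_cast h2

/-- The non-constant Fourier indices of size at most `t`, of which there are `2 M(t)`. -/
theorem exists_finset_fourierIndex {t : ℝ} (ht : 0 ≤ t) :
    ∃ I : Finset FourierIndex, (I.card : ℝ) = 2 * countM t ∧
      ∀ j ∈ I, j.1.2 ≠ 0 ∧ (j.size : ℝ) ≤ t := by
  classical
  -- The size constraint decouples into m_ℓ ≤ ⌊t/ℓ²⌋ for each ℓ, so the count is a product; removing
  -- m = 0 gives M(t), and the two values of a double it.
  set F : Finset (ℕ →₀ ℕ) := (Finset.range ⌊t⌋₊).finsupp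
    fun l => Finset.range (⌊t / ((l : ℝ) + 1) ^ 2⌋₊ + 1) with hF
  set E : Finset (Fin 2 × (ℕ →₀ ℕ)) := Finset.univ ×ˢ F.erase 0 with hE
  have hE0 (p) (hp : p ∈ E) : p.2 ≠ 0 := Finset.ne_of_mem_erase (Finset.mem_product.1 hp).2
  have h0F : (0 : ℕ →₀ ℕ) ∈ F := by
    rw [hF, Finset.mem_finsupp_iff]
    simp
  refine ⟨E.subtype (fun j => j ≠ (1, 0)), ?_, fun j hj => ?_⟩
  · have hfilter : E.filter (fun j => j ≠ (1, 0)) = E :=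
      Finset.filter_true_of_mem fun p hp h => hE0 p hp (by rw [h])
    rw [Finset.card_subtype, hfilter,
      Finset.card_product, Finset.card_univ, Fintype.card_fin, countM_eq_prod]
    have h1 : F.card = ∏ l ∈ Finset.range ⌊t⌋₊, (⌊t / ((l : ℝ) + 1) ^ 2⌋₊ + 1) := by
      rw [hF, Finset.card_finsupp]
      simp
    rw [← h1, ← Finset.card_erase_add_one h0F]
    push_cast
    ring
  · rw [Finset.mem_subtype] at hj
    refine ⟨hE0 _ hj, ?_⟩
    have hjF := Finset.mem_of_mem_erase (Finset.mem_product.1 hj).2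
    rw [hF, Finset.mem_finsupp_iff] at hjF
    have hsize : j.size ≤ ⌊t⌋₊ := by
      refine Finset.sup_le fun l hl => Nat.le_floor ?_
      have h1 := Nat.lt_succ_iff.1 (Finset.mem_range.1 (hjF.2 l (hjF.1 hl)))
      have h2 := (Nat.le_floor_iff (by positivity)).1 h1
      rw [le_div_iff₀ (by positivity)] at h2
      push_cast
      linarith
    exact (Nat.le_floor_iff ht).1 hsize

end Counting

/-! ### The growth bound M(t) ≤ exp(c₀√t) -/

section EffectiveDimension

/-- Abel summation; the boundary term tends to 0, so both series have sum c₀. -/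
theorem sum_range_inv_sqrt_mul_log (K : ℕ) :
    ∑ k ∈ Finset.range K, (Real.sqrt ((k : ℝ) + 1))⁻¹ *
        (Real.log ((k : ℝ) + 2) - Real.log ((k : ℝ) + 1)) =
      ∑ k ∈ Finset.range K, ((Real.sqrt ((k : ℝ) + 1))⁻¹ - (Real.sqrt ((k : ℝ) + 2))⁻¹) *
        Real.log ((k : ℝ) + 2) + (Real.sqrt ((K : ℝ) + 1))⁻¹ * Real.log ((K : ℝ) + 1) := by
  induction K with
  | zero => simp
  | succ K ih =>
    rw [Finset.sum_range_succ, ih, Finset.sum_range_succ]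
    push_cast
    rw [show (K : ℝ) + 1 + 1 = K + 2 by ring]
    ring

theorem log_succ_sub_log_nonneg (k : ℕ) :
    0 ≤ Real.log ((k : ℝ) + 2) - Real.log ((k : ℝ) + 1) :=
  sub_nonneg.2 (Real.log_le_log (by positivity) (by linarith))

theorem effectiveDim_term_nonneg (k : ℕ) :
    0 ≤ ((Real.sqrt ((k : ℝ) + 1))⁻¹ - (Real.sqrt ((k : ℝ) + 2))⁻¹) *
      Real.log ((k : ℝ) + 2) := by
  refine mul_nonneg (sub_nonneg.2 (inv_anti₀ (by positivity) (Real.sqrt_le_sqrt ?_)))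
    (Real.log_nonneg ?_) <;> linarith [Nat.cast_nonneg (α := ℝ) k]

theorem summable_inv_sqrt_mul_log : Summable fun k : ℕ => (Real.sqrt ((k : ℝ) + 1))⁻¹ *
    (Real.log ((k : ℝ) + 2) - Real.log ((k : ℝ) + 1)) := by
  have h : Summable fun k : ℕ => 1 / ((k + 1 : ℕ) : ℝ) ^ (3 / 2 : ℝ) :=
    (summable_nat_add_iff 1).2 (Real.summable_one_div_nat_rpow.2 (by norm_num))
  refine Summable.of_nonneg_of_le
    (fun k => mul_nonneg (by positivity) (log_succ_sub_log_nonneg k)) (fun k => ?_) h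
  have hk : (0 : ℝ) < (k : ℝ) + 1 := by positivity
  have h1 : Real.log ((k : ℝ) + 2) - Real.log ((k : ℝ) + 1) ≤ ((k : ℝ) + 1)⁻¹ := by
    rw [← Real.log_div (by positivity) (by positivity)]
    refine (Real.log_le_sub_one_of_pos (by positivity)).trans_eq ?_
    field_simp
    ring
  have h2 : ((k + 1 : ℕ) : ℝ) ^ (3 / 2 : ℝ) = Real.sqrt ((k : ℝ) + 1) * ((k : ℝ) + 1) := by
    push_cast
    rw [Real.sqrt_eq_rpow, ← Real.rpow_add_one hk.ne']
    norm_num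
  rw [h2, one_div, mul_inv]
  gcongr

theorem summable_effectiveDim : Summable fun k : ℕ =>
    ((Real.sqrt ((k : ℝ) + 1))⁻¹ - (Real.sqrt ((k : ℝ) + 2))⁻¹) * Real.log ((k : ℝ) + 2) := by
  refine summable_of_sum_range_le (c := ∑' k : ℕ, (Real.sqrt ((k : ℝ) + 1))⁻¹ *
    (Real.log ((k : ℝ) + 2) - Real.log ((k : ℝ) + 1))) effectiveDim_term_nonneg fun K => ?_
  refine le_trans ?_ (summable_inv_sqrt_mul_log.sum_le_tsum (Finset.range K) fun k _ =>
    mul_nonneg (by positivity) (log_succ_sub_log_nonneg k))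
  rw [sum_range_inv_sqrt_mul_log]
  have : 0 ≤ (Real.sqrt ((K : ℝ) + 1))⁻¹ * Real.log ((K : ℝ) + 1) :=
    mul_nonneg (by positivity) (Real.log_nonneg (by linarith [Nat.cast_nonneg (α := ℝ) K]))
  linarith

theorem effectiveDim_nonneg : 0 ≤ effectiveDim := tsum_nonneg effectiveDim_term_nonneg

theorem sum_range_inv_sqrt_mul_log_le (K : ℕ) :
    ∑ k ∈ Finset.range K, (Real.sqrt ((k : ℝ) + 1))⁻¹ *
        (Real.log ((k : ℝ) + 2) - Real.log ((k : ℝ) + 1)) ≤ effectiveDim := by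
  have hlim : Filter.Tendsto (fun N : ℕ => effectiveDim +
      (Real.sqrt ((N : ℝ) + 1))⁻¹ * Real.log ((N : ℝ) + 1)) Filter.atTop
      (nhds (effectiveDim + 0)) := by
    refine tendsto_const_nhds.add ?_
    have h1 := (isLittleO_log_rpow_atTop (half_pos one_pos : (0 : ℝ) < 1 / 2)).tendsto_div_nhds_zero
    have h2 := h1.comp (Filter.tendsto_atTop_add_const_right _ (1 : ℝ)
      (tendsto_natCast_atTop_atTop (R := ℝ)))
    refine h2.congr fun N => ?_
    simp only [Function.comp_apply, Real.sqrt_eq_rpow]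
    rw [div_eq_inv_mul]
  rw [add_zero] at hlim
  refine ge_of_tendsto hlim (Filter.eventually_atTop.2 ⟨K, fun N hN => ?_⟩)
  refine (Finset.sum_le_sum_of_subset_of_nonneg (Finset.range_mono hN) fun k _ _ =>
    mul_nonneg (by positivity) (log_succ_sub_log_nonneg k)).trans ?_
  rw [sum_range_inv_sqrt_mul_log]
  gcongr
  exact summable_effectiveDim.sum_le_tsum _ fun k _ => effectiveDim_term_nonneg k

theorem log_one_add_floor_eq_sum {x : ℝ} {K : ℕ} (hx : 0 ≤ x) (hK : ⌊x⌋₊ ≤ K) :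
    Real.log (1 + (⌊x⌋₊ : ℝ)) = ∑ k ∈ Finset.range K, if (k : ℝ) + 1 ≤ x then
      Real.log ((k : ℝ) + 2) - Real.log ((k : ℝ) + 1) else 0 := by
  rw [← Finset.sum_filter]
  have h1 : (Finset.range K).filter (fun k : ℕ => (k : ℝ) + 1 ≤ x) = Finset.range ⌊x⌋₊ := by
    ext k
    simp only [Finset.mem_filter, Finset.mem_range]
    have : (k : ℝ) + 1 ≤ x ↔ k + 1 ≤ ⌊x⌋₊ := by
      rw [Nat.le_floor_iff hx]
      push_cast
      rfl
    rw [this]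
    omega
  rw [h1]
  have h2 := Finset.sum_range_sub (fun k : ℕ => Real.log ((k : ℝ) + 1)) ⌊x⌋₊
  simp only [Nat.cast_zero, zero_add, Real.log_one, sub_zero] at h2
  rw [add_comm, ← h2]
  refine Finset.sum_congr rfl fun k _ => ?_
  push_cast
  rw [show (k : ℝ) + 1 + 1 = k + 2 by ring]

/-- Each log(1 + ⌊t/ℓ²⌋) is a telescoping sum of log((k+2)/(k+1)) over k + 1 ≤ t/ℓ². After
exchanging sums, each k is counted for at most √(t/(k+1)) values of ℓ, which leaves √t times partial
sums of the series for c₀. -/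
theorem countM_le_exp {t : ℝ} (ht : 0 ≤ t) :
    countM t ≤ Real.exp (effectiveDim * Real.sqrt t) := by
  have hsum : ∑ l ∈ Finset.range ⌊t⌋₊, Real.log (1 + (⌊t / ((l : ℝ) + 1) ^ 2⌋₊ : ℝ)) ≤
      effectiveDim * Real.sqrt t := by
    have h1 (l : ℕ) : Real.log (1 + (⌊t / ((l : ℝ) + 1) ^ 2⌋₊ : ℝ)) =
        ∑ k ∈ Finset.range ⌊t⌋₊, if (k : ℝ) + 1 ≤ t / ((l : ℝ) + 1) ^ 2 then
          Real.log ((k : ℝ) + 2) - Real.log ((k : ℝ) + 1) else 0 := by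
      refine log_one_add_floor_eq_sum (by positivity) (Nat.floor_le_floor
        (div_le_self ht (one_le_pow₀ ?_)))
      linarith [Nat.cast_nonneg (α := ℝ) l]
    simp_rw [h1]
    rw [Finset.sum_comm]
    refine (Finset.sum_le_sum fun k _ => ?_).trans (?_ : ∑ k ∈ Finset.range ⌊t⌋₊,
      ((Real.sqrt ((k : ℝ) + 1))⁻¹ * (Real.log ((k : ℝ) + 2) - Real.log ((k : ℝ) + 1))) *
        Real.sqrt t ≤ _)
    · rw [← Finset.sum_filter, Finset.sum_const, nsmul_eq_mul]
      have h2 : ((Finset.range ⌊t⌋₊).filter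
          (fun l : ℕ => (k : ℝ) + 1 ≤ t / ((l : ℝ) + 1) ^ 2)).card ≤
          ⌊Real.sqrt t / Real.sqrt ((k : ℝ) + 1)⌋₊ := by
        rw [← Finset.card_range ⌊Real.sqrt t / Real.sqrt ((k : ℝ) + 1)⌋₊]
        refine Finset.card_le_card fun l hl => ?_
        have h3 := (Finset.mem_filter.1 hl).2
        rw [Finset.mem_range, ← Nat.add_one_le_iff, Nat.le_floor_iff (by positivity),
          ← Real.sqrt_div ht]
        refine Real.le_sqrt_of_sq_le ?_
        rw [le_div_iff₀ (by positivity)] at h3 ⊢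
        push_cast
        linarith
      have h4 := (Nat.cast_le (α := ℝ).2 h2).trans
        (Nat.floor_le (by positivity : 0 ≤ Real.sqrt t / Real.sqrt ((k : ℝ) + 1)))
      calc _ ≤ (Real.sqrt t / Real.sqrt ((k : ℝ) + 1)) *
            (Real.log ((k : ℝ) + 2) - Real.log ((k : ℝ) + 1)) :=
            mul_le_mul_of_nonneg_right h4 (log_succ_sub_log_nonneg k)
        _ = _ := by ring
    · rw [← Finset.sum_mul]
      exact mul_le_mul_of_nonneg_right (sum_range_inv_sqrt_mul_log_le _) (Real.sqrt_nonneg t)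
  rw [countM, tsum_log_floor_eq_sum]
  have := Real.exp_le_exp.2 hsum
  linarith

end EffectiveDimension

/-! ### The truncation level and the size of the family -/

section Truncation

theorem exists_truncLevel_bounds {sX : ℝ} (sY : ℝ) (hsX : 0 < sX) (hsY : 0 < sY) :
    ∃ t₀ : ℝ, 1 ≤ t₀ ∧ ∀ t, t₀ ≤ t →
      2 ≤ truncLevel sX sY t ∧ (truncLevel sX sY t : ℝ) ≤ t ^ 2 := by
  -- The first threshold makes both factors M at least 1 when m = 1, which rules out level 1. The
  -- second gives 1/m < 4s_X at m = ⌊t²⌋, so that log(t/√m) < 2s_X and the factor M for X vanishes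
  -- there.
  refine ⟨max (Real.exp (2 * max sX sY)) (2 + 1 / (4 * sX)), ?_, fun t ht => ?_⟩
  · refine le_max_of_le_right ?_
    have : 0 < 1 / (4 * sX) := by positivity
    linarith
  have ht1 := (le_max_left _ _).trans ht
  have ht2 := (le_max_right _ _).trans ht
  have h4 : 0 < 1 / (4 * sX) := by positivity
  have htpos : 2 < t := by linarith
  have hlog : 2 * max sX sY ≤ Real.log t := (Real.le_log_iff_exp_le (by linarith)).2 ht1
  have hone {s : ℝ} (hs : 0 < s) (h : s ≤ max sX sY) :
      1 ≤ countM (Real.log (t / Real.sqrt (1 : ℕ)) ^ 2 / (4 * s ^ 2)) := by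
    refine one_le_countM ?_
    rw [Nat.cast_one, Real.sqrt_one, div_one, le_div_iff₀ (by positivity)]
    nlinarith
  set m := ⌊t ^ 2⌋₊ with hm
  have hmle : (m : ℝ) ≤ t ^ 2 := Nat.floor_le (by positivity)
  have hmlt : t ^ 2 < m + 1 := Nat.lt_floor_add_one _
  have hmt : t ≤ m := by nlinarith
  have hm0 : (0 : ℝ) < m := by linarith
  have hmem : m ∈ {m : ℕ | 1 ≤ m ∧
      countM (Real.log (t / Real.sqrt m) ^ 2 / (4 * sX ^ 2)) *
        countM (Real.log (t / Real.sqrt m) ^ 2 / (4 * sY ^ 2)) < (m : ℝ) / 4} := by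
    refine ⟨Nat.one_le_iff_ne_zero.2 fun h => hm0.ne' (by rw [h, Nat.cast_zero]), ?_⟩
    rw [countM_eq_zero, zero_mul]
    · positivity
    · have hs : 0 < Real.sqrt m := Real.sqrt_pos.2 hm0
      have hx : 1 ≤ t / Real.sqrt m := by
        rw [le_div_iff₀ hs, one_mul]
        exact Real.sqrt_le_iff.2 ⟨by linarith, hmle⟩
      have hl0 : 0 ≤ Real.log (t / Real.sqrt m) := Real.log_nonneg hx
      have hsq : (t / Real.sqrt m) ^ 2 = t ^ 2 / m := by rw [div_pow, Real.sq_sqrt hm0.le]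
      have hl1 : 2 * Real.log (t / Real.sqrt m) ≤ 1 / m := by
        have h1 : 2 * Real.log (t / Real.sqrt m) = Real.log (t ^ 2 / m) := by
          rw [← hsq, Real.log_pow]
          norm_num
        rw [h1]
        refine (Real.log_le_sub_one_of_pos (by positivity)).trans ?_
        rw [div_sub_one hm0.ne']
        gcongr
        linarith
      have hl2 : 1 / (m : ℝ) < 4 * sX := by
        rw [div_lt_comm₀ hm0 (by positivity)]
        linarith
      rw [div_lt_one (by positivity)]
      nlinarith
  have hspec := Nat.sInf_mem ⟨m, hmem⟩
  refine ⟨?_, ?_⟩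
  · by_contra! hlt
    have h1 : truncLevel sX sY t = 1 := le_antisymm (Nat.lt_succ_iff.1 hlt) hspec.1
    have h2 := hspec.2
    change countM (Real.log (t / Real.sqrt (truncLevel sX sY t)) ^ 2 / (4 * sX ^ 2)) *
      countM (Real.log (t / Real.sqrt (truncLevel sX sY t)) ^ 2 / (4 * sY ^ 2)) <
      (truncLevel sX sY t : ℝ) / 4 at h2
    rw [h1] at h2
    have h3 := one_le_mul_of_one_le_of_one_le (hone hsX (le_max_left _ _))
      (hone hsY (le_max_right _ _))
    norm_num at h2 h3
    linarith
  · exact le_trans (by exact_mod_cast Nat.sInf_le hmem) hmle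

theorem le_countM_mul_countM_of_lt_truncLevel {sX sY t : ℝ} {m : ℕ} (hm : 1 ≤ m)
    (h : m < truncLevel sX sY t) :
    (m : ℝ) / 4 ≤ countM (Real.log (t / Real.sqrt m) ^ 2 / (4 * sX ^ 2)) *
      countM (Real.log (t / Real.sqrt m) ^ 2 / (4 * sY ^ 2)) := by
  have := Nat.notMem_of_lt_sInf h
  simp only [Set.mem_ofPred_eq, not_and, not_lt] at this
  exact this hm

theorem sqrt_log_sq_div {s x : ℝ} (hs : 0 < s) (hx : 1 ≤ x) :
    Real.sqrt (Real.log x ^ 2 / (4 * s ^ 2)) = Real.log x / (2 * s) := by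
  have h : Real.log x ^ 2 / (4 * s ^ 2) = (Real.log x / (2 * s)) ^ 2 := by
    rw [div_pow]; ring
  rw [h, Real.sqrt_sq (div_nonneg (Real.log_nonneg hx) (by positivity))]

theorem expWeight_sq_le {sX sY x : ℝ} (hsX : 0 < sX) (hsY : 0 < sY) (hx : 1 ≤ x)
    {j k : FourierIndex} (hj : (j.size : ℝ) ≤ Real.log x ^ 2 / (4 * sX ^ 2))
    (hk : (k.size : ℝ) ≤ Real.log x ^ 2 / (4 * sY ^ 2)) :
    expWeight sX sY j k ^ 2 ≤ ENNReal.ofReal x := by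
  have key {s : ℝ} (hs : 0 < s) {i : FourierIndex}
      (hi : (i.size : ℝ) ≤ Real.log x ^ 2 / (4 * s ^ 2)) :
      Real.exp (s * Real.sqrt i.size) ≤ Real.exp (Real.log x / 2) := by
    refine Real.exp_le_exp.2 ?_
    have h1 := Real.sqrt_le_sqrt hi
    rw [sqrt_log_sq_div hs hx] at h1
    calc s * Real.sqrt i.size ≤ s * (Real.log x / (2 * s)) := by gcongr
      _ = Real.log x / 2 := by field_simp
  rw [expWeight, ← ENNReal.ofReal_pow (le_max_of_le_left (Real.exp_pos _).le)]
  refine ENNReal.ofReal_le_ofReal ?_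
  calc _ ≤ Real.exp (Real.log x / 2) ^ 2 :=
        pow_le_pow_left₀ (le_max_of_le_left (Real.exp_pos _).le)
          (max_le (key hsX hj) (key hsY hk)) 2
    _ = x := by
        rw [← Real.exp_nat_mul]
        norm_num
        rw [mul_div_cancel₀ _ two_ne_zero, Real.exp_log (by linarith)]

/-- A family of `m` pairs of non-constant indices of sizes at most `u` and `v`. -/
theorem exists_injective_family {u v : ℝ} (hu : 0 ≤ u) (hv : 0 ≤ v) {m : ℕ}
    (hm : (m : ℝ) / 4 ≤ countM u * countM v) :
    ∃ b : Fin m → FourierIndex × FourierIndex, Function.Injective b ∧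
      (∀ i, (b i).1.1.2 ≠ 0) ∧ (∀ i, (b i).2.1.2 ≠ 0) ∧
      (∀ i, ((b i).1.size : ℝ) ≤ u) ∧ ∀ i, ((b i).2.size : ℝ) ≤ v := by
  obtain ⟨I, hI, hI'⟩ := exists_finset_fourierIndex hu
  obtain ⟨J, hJ, hJ'⟩ := exists_finset_fourierIndex hv
  have hcard : m ≤ (I ×ˢ J).card := by
    have : (m : ℝ) ≤ ((I ×ˢ J).card : ℕ) := by
      rw [Finset.card_product, Nat.cast_mul, hI, hJ]
      linarith
    exact_mod_cast this
  obtain ⟨B, hB, hBm⟩ := Finset.exists_subset_card_eq hcard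
  have hmem (i : Fin m) := Finset.mem_product.1 (hB ((B.equivFinOfCardEq hBm).symm i).2)
  exact ⟨fun i => ((B.equivFinOfCardEq hBm).symm i : FourierIndex × FourierIndex),
    Subtype.val_injective.comp (Equiv.injective _), fun i => (hI' _ (hmem i).1).1,
    fun i => (hJ' _ (hmem i).2).1, fun i => (hI' _ (hmem i).1).2, fun i => (hJ' _ (hmem i).2).2⟩

theorem log_le_of_div_four_le_countM {sX sY x m : ℝ} (hsX : 0 < sX) (hsY : 0 < sY) (hx : 1 ≤ x)
    (hm0 : 0 < m) (hm : m / 4 ≤ countM (Real.log x ^ 2 / (4 * sX ^ 2)) *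
      countM (Real.log x ^ 2 / (4 * sY ^ 2))) :
    Real.log m - Real.log 4 ≤ effectiveDim / meanSmoothness sX sY * Real.log x := by
  have h1 := countM_le_exp (t := Real.log x ^ 2 / (4 * sX ^ 2)) (by positivity)
  have h2 := countM_le_exp (t := Real.log x ^ 2 / (4 * sY ^ 2)) (by positivity)
  rw [sqrt_log_sq_div hsX hx] at h1
  rw [sqrt_log_sq_div hsY hx] at h2
  have h3 := hm.trans (mul_le_mul h1 h2 (countM_nonneg _) (Real.exp_pos _).le)
  rw [← Real.exp_add] at h3
  rw [← Real.log_div hm0.ne' (by norm_num), Real.log_le_iff_le_exp (by positivity)]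
  refine h3.trans_eq ?_
  congr 1
  rw [meanSmoothness]
  field_simp

theorem meanSmoothness_pos {sX sY : ℝ} (hsX : 0 < sX) (hsY : 0 < sY) :
    0 < meanSmoothness sX sY := by
  unfold meanSmoothness
  positivity

/-- The hypothesis bounds log m by a quantity that itself contains -log m / 2. Solving for log m
gives the coefficient 2s + c, and (1 + s/(s+c)) · 2c = (2s + c) · 2(1 - s/(s+c)) makes the powers of
n match. -/
theorem le_four_mul_rpow {s c t m n : ℝ} (hs : 0 < s) (hc : 0 ≤ c) (hm : 0 < m) (hn : 0 < n)
    (ht : 0 < t) (h : Real.log m - Real.log 4 ≤ c / s * Real.log (t / Real.sqrt m))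
    (htn : Real.log t ≤ (1 + s / (s + c)) * Real.log n) :
    Real.sqrt m ≤ 2 * n ^ (1 - s / (s + c)) := by
  rw [Real.log_div ht.ne' (Real.sqrt_pos.2 hm).ne', Real.log_sqrt hm.le] at h
  have hl4 : 0 ≤ Real.log 4 := Real.log_nonneg (by norm_num)
  have h1 : s * (Real.log m - Real.log 4) ≤ c * (Real.log t - Real.log m / 2) := by
    calc _ ≤ s * (c / s * (Real.log t - Real.log m / 2)) := by gcongr
      _ = _ := by field_simp
  have h2 : (2 * s + c) * Real.log m ≤ 2 * s * Real.log 4 + 2 * c * Real.log t := by linarith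
  have h3 : 2 * c * Real.log t ≤ 2 * c * ((1 + s / (s + c)) * Real.log n) := by gcongr
  have h4 : 2 * c * ((1 + s / (s + c)) * Real.log n) =
      (2 * s + c) * (2 * (1 - s / (s + c)) * Real.log n) := by
    field_simp
    ring
  have h5 : (2 * s + c) * Real.log m ≤
      (2 * s + c) * (Real.log 4 + 2 * (1 - s / (s + c)) * Real.log n) := by
    nlinarith
  have h6 := le_of_mul_le_mul_left h5 (by positivity)
  have hlog4 : Real.log 4 = 2 * Real.log 2 := by
    rw [show (4 : ℝ) = 2 ^ 2 by norm_num, Real.log_pow]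
    norm_num
  rw [← Real.log_le_log_iff (Real.sqrt_pos.2 hm) (by positivity), Real.log_sqrt hm.le,
    Real.log_mul two_ne_zero (by positivity), Real.log_rpow hn]
  linarith

/-- The three requirements are that the grid entropy is dominated, that the bad signs are rare, and
that the discretisation error is small. -/
theorem exists_sample_size_threshold {K κ σ q a : ℝ} (hκ : 0 < κ) (hσ : 0 < σ) (hq : q < 1)
    (ha : 0 < a) :
    ∃ n₀ : ℝ, ∀ n, n₀ ≤ n → 8 * K * Real.log n ^ 3 ≤ κ * n ^ σ ∧
      2 * Real.exp (-(κ * n ^ σ)) ≤ 1 - q ∧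
      32 * Real.pi * K ^ 2 * Real.log n ^ 4 ≤ a / 2 * n := by
  refine Filter.eventually_atTop.1 ?_
  have e1 : ∀ᶠ n : ℝ in Filter.atTop, 8 * K * Real.log n ^ 3 ≤ κ * n ^ σ := by
    have h := ((isLittleO_log_rpow_rpow_atTop 3 hσ).const_mul_left (8 * K)).bound hκ
    filter_upwards [h, Filter.eventually_ge_atTop 1] with n hn hn1
    have h2 := (le_abs_self _).trans hn
    rw [Real.norm_eq_abs, abs_of_nonneg (by positivity)] at h2
    simpa using h2
  have e2 : ∀ᶠ n : ℝ in Filter.atTop, 2 * Real.exp (-(κ * n ^ σ)) ≤ 1 - q := by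
    have h := (Real.tendsto_exp_neg_atTop_nhds_zero.comp
      ((tendsto_rpow_atTop hσ).const_mul_atTop hκ)).const_mul 2
    rw [mul_zero] at h
    exact h.eventually_le_const (by linarith)
  have e3 : ∀ᶠ n : ℝ in Filter.atTop,
      32 * Real.pi * K ^ 2 * Real.log n ^ 4 ≤ a / 2 * n := by
    have h := ((Real.isLittleO_pow_log_id_atTop (n := 4)).const_mul_left
      (32 * Real.pi * K ^ 2)).bound (half_pos ha)
    filter_upwards [h, Filter.eventually_ge_atTop 1] with n hn hn1
    have h2 := (le_abs_self _).trans hn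
    rwa [id, Real.norm_eq_abs, abs_of_nonneg (by linarith)] at h2
  exact e1.and (e2.and e3)

end Truncation

/-! ### Numerical estimates for the final choice of parameters -/

section LowerBound

theorem rpow_quarter_bound {c m M n : ℝ} (hc : 0 ≤ c) (hM : 0 ≤ M) (hm : 0 ≤ m)
    (hn : 0 ≤ n) (hMm : M ≤ 2 * m) :
    (Real.sqrt c / 2 * M ^ (1 / 4 : ℝ) / n ^ (1 / 2 : ℝ)) ^ 2 ≤ c * Real.sqrt m / n := by
  have h1 : (M ^ (1 / 4 : ℝ)) ^ 2 = Real.sqrt M := by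
    rw [← Real.rpow_natCast, ← Real.rpow_mul hM, Real.sqrt_eq_rpow]
    norm_num
  have h2 : (n ^ (1 / 2 : ℝ)) ^ 2 = n := by rw [← Real.sqrt_eq_rpow, Real.sq_sqrt hn]
  rw [div_pow, mul_pow, div_pow, h1, h2, Real.sq_sqrt hc]
  have h3 : Real.sqrt M ≤ 2 * Real.sqrt m := by
    refine Real.sqrt_le_iff.2 ⟨by positivity, ?_⟩
    rw [mul_pow, Real.sq_sqrt hm]
    linarith
  gcongr ?_ / n
  calc c / 2 ^ 2 * Real.sqrt M ≤ c / 2 ^ 2 * (2 * Real.sqrt m) := by gcongr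
    _ ≤ c * Real.sqrt m := by linarith [mul_nonneg hc (Real.sqrt_nonneg m)]

theorem deviation_exponent_bound {a c S N n : ℝ} (hc : 0 < c) (hc1 : c ≤ 1) (hS : 0 < S)
    (hN : 0 ≤ N) (h : S * N ≤ 2 * n) : 2 * (a ^ 2 / 128 * N) ≤ a ^ 2 * n / (32 * (c * S)) := by
  rw [le_div_iff₀ (by positivity)]
  calc 2 * (a ^ 2 / 128 * N) * (32 * (c * S)) = a ^ 2 / 2 * (c * (S * N)) := by ring
    _ ≤ a ^ 2 / 2 * (1 * (2 * n)) := by gcongr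
    _ = a ^ 2 * n := by ring

/-- Half of the deviation exponent `E` absorbs the cardinality of the grid of mesh n⁻³; the other
half remains as the failure probability. -/
theorem net_size_bound {n L κ E q : ℝ} {T : ℕ} (hn : 2 ≤ n) (hT : (T : ℝ) ≤ L)
    (h : 8 * L * Real.log n ≤ κ) (hE : 2 * κ ≤ E) (hq : 2 * Real.exp (-κ) ≤ 1 - q) :
    (n ^ 3 + 1) ^ (2 * T) * (2 * Real.exp (-E)) ≤ 1 - q := by
  have hlog : 0 ≤ Real.log n := Real.log_nonneg (by linarith)
  have h1 : n ^ 3 + 1 ≤ Real.exp (4 * Real.log n) := by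
    have : Real.exp (4 * Real.log n) = n ^ 4 := by
      rw [← Real.exp_log (by linarith : 0 < n), Real.log_exp, ← Real.exp_nat_mul]
      norm_num
    rw [this]
    nlinarith [one_le_pow₀ (by linarith : 1 ≤ n) (n := 3)]
  have h2 : (n ^ 3 + 1) ^ (2 * T) ≤ Real.exp κ := by
    refine (pow_le_pow_left₀ (by positivity) h1 _).trans ?_
    rw [← Real.exp_nat_mul]
    refine Real.exp_le_exp.2 ?_
    push_cast
    calc 2 * (T : ℝ) * (4 * Real.log n) = 8 * T * Real.log n := by ring
      _ ≤ 8 * L * Real.log n := by gcongr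
      _ ≤ κ := h
  calc _ ≤ Real.exp κ * (2 * Real.exp (-(2 * κ))) := by gcongr
    _ = 2 * Real.exp (-κ) := by
      rw [mul_left_comm, ← Real.exp_add]
      ring_nf
    _ ≤ _ := hq

end LowerBound

end IndepTesting

/-! ### Choice of parameters and conclusion -/

open IndepTesting in
set_option maxHeartbeats 800000 in
theorem IndepTesting.le_cubeRadius_of_large {α β sX sY A η lam q a : ℝ}
    (hα : 0 ≤ α) (hβ : 0 ≤ β) (hsX : 0 < sX) (hsY : 0 < sY)
    (ha : 0 < a) (ha1 : a ≤ 1) (hA : 1 + a ≤ A) (hη : 0 < η) (hαβ : α + β < 1 - η)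
    (hlam : 0 < lam) (hlam1 : lam ≤ 1) (hq : 0 < q)
    (hchi : Real.exp (lam / 2) ≤ (1 + η ^ 2) * q ^ 2) {n m : ℕ} {r : ℝ} (hn : 2 ≤ n)
    (hr : 0 < r) (hm : 1 ≤ m) (hmt : m < truncLevel sX sY (n * r ^ 2))
    (hm2 : (truncLevel sX sY (n * r ^ 2) : ℝ) ≤ (n * r ^ 2) ^ 2)
    (hrn : r ^ 2 ≤ (n : ℝ) ^ (meanSmoothness sX sY / (meanSmoothness sX sY + effectiveDim)))
    (h1 : 8 * (1 / min sX sY ^ 2) * Real.log n ^ 3 ≤ a ^ 2 / 128 *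
      (n : ℝ) ^ (meanSmoothness sX sY / (meanSmoothness sX sY + effectiveDim)))
    (h2 : 2 * Real.exp (-(a ^ 2 / 128 *
      (n : ℝ) ^ (meanSmoothness sX sY / (meanSmoothness sX sY + effectiveDim)))) ≤ 1 - q)
    (h3 : 32 * Real.pi * (1 / min sX sY ^ 2) ^ 2 * Real.log n ^ 4 ≤ a / 2 * n)
    {ρ : ℝ} (hρ : ρ ^ 2 ≤ Real.sqrt lam * Real.sqrt m / n) :
    ρ ≤ cubeRadius n α β sX sY r A := by
  set σ := meanSmoothness sX sY / (meanSmoothness sX sY + effectiveDim) with hσdef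
  set t : ℝ := n * r ^ 2 with ht
  have hs := meanSmoothness_pos hsX hsY
  have hc := effectiveDim_nonneg
  have hσ : 0 < σ := by positivity
  have hσ1 : σ ≤ 1 := div_le_one_of_le₀ (by linarith) (by positivity)
  have hn2 : (2 : ℝ) ≤ n := by exact_mod_cast hn
  have hn0 : (0 : ℝ) < n := by linarith
  have hm1 : (1 : ℝ) ≤ m := by exact_mod_cast hm
  have hm0 : (0 : ℝ) < m := by linarith
  have ht0 : 0 < t := by positivity
  have hlogn : 0 ≤ Real.log n := Real.log_nonneg (by linarith)
  have hsm : 0 < Real.sqrt m := Real.sqrt_pos.2 hm0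
  have hsm1 : 1 ≤ Real.sqrt m := Real.one_le_sqrt.2 hm1
  -- This ensures x ≥ 1, so log²x is monotone in x and √(log²x) = log x.
  have hsmle : Real.sqrt m ≤ t := by
    refine Real.sqrt_le_iff.2 ⟨ht0.le, le_trans ?_ hm2⟩
    exact_mod_cast hmt.le
  set x := t / Real.sqrt m with hx
  have hx1 : 1 ≤ x := by rwa [hx, le_div_iff₀ hsm, one_mul]
  have hlogx : 0 ≤ Real.log x := Real.log_nonneg hx1
  have hcount := le_countM_mul_countM_of_lt_truncLevel hm hmt
  obtain ⟨b, hb, hb1, hb2, hbX, hbY⟩ := exists_injective_family (by positivity) (by positivity)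
    hcount
  have hlogt : Real.log t ≤ (1 + σ) * Real.log n := by
    rw [ht, Real.log_mul hn0.ne' (by positivity), add_mul, one_mul]
    gcongr
    rw [← Real.log_rpow hn0]
    exact Real.log_le_log (by positivity) hrn
  have hlogxn : Real.log x ≤ 2 * Real.log n := by
    refine (Real.log_le_log (by positivity) (div_le_self ht0.le hsm1)).trans (hlogt.trans ?_)
    gcongr
    linarith
  have hsqrt : Real.sqrt m ≤ 2 * (n : ℝ) ^ (1 - σ) :=
    le_four_mul_rpow hs hc hm0 hn0 ht0 (log_le_of_div_four_le_countM hsX hsY hx1 hm0 hcount) hlogt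
  have hsqrtn : Real.sqrt m * (n : ℝ) ^ σ ≤ 2 * n := by
    calc _ ≤ 2 * (n : ℝ) ^ (1 - σ) * (n : ℝ) ^ σ := by gcongr
      _ = 2 * n := by rw [mul_assoc, ← Real.rpow_add hn0, sub_add_cancel, Real.rpow_one]
  have hmn : (m : ℝ) ≤ 4 * n ^ 2 := by
    have h : Real.sqrt m ≤ 2 * n := by
      refine hsqrt.trans ?_
      gcongr
      calc (n : ℝ) ^ (1 - σ) ≤ (n : ℝ) ^ (1 : ℝ) :=
            Real.rpow_le_rpow_of_exponent_le (by linarith) (by linarith)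
        _ = n := Real.rpow_one _
    have h' := (Real.sqrt_le_left (by positivity)).1 h
    linarith
  set c := Real.sqrt lam with hcdef
  have hc0 : 0 < c := Real.sqrt_pos.2 hlam
  have hc1 : c ≤ 1 := Real.sqrt_le_one.2 hlam1
  -- Chosen so that m(nδ²)² = c² = lam, the largest second moment allowed, while mδ² = c√m/n.
  set δ := Real.sqrt (c / (n * Real.sqrt m)) with hδ
  have hδ0 : 0 < δ := Real.sqrt_pos.2 (by positivity)
  have hδ2 : δ ^ 2 = c / (n * Real.sqrt m) := Real.sq_sqrt (by positivity)
  have hδ1 : δ ≤ 1 := by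
    refine Real.sqrt_le_one.2 (div_le_one_of_le₀ ?_ (by positivity))
    nlinarith
  set μ := min sX sY with hμ
  have hμ0 : 0 < μ := lt_min hsX hsY
  -- Since log x ≤ 2 log n, this bounds every index size in the family, hence also the number of
  -- coordinates involved.
  set Q := (1 / μ ^ 2) * Real.log n ^ 2 with hQ
  have hQ0 : 0 ≤ Q := by positivity
  have hbound {s : ℝ} (hs : μ ≤ s) : Real.log x ^ 2 / (4 * s ^ 2) ≤ Q := by
    calc _ ≤ (2 * Real.log n) ^ 2 / (4 * μ ^ 2) := by gcongr
      _ = Q := by rw [hQ]; field_simp; ring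
  have hT : (⌊Q⌋₊ : ℝ) ≤ Q := Nat.floor_le hQ0
  have hmδ : m * δ ^ 2 = c * Real.sqrt m / n := by
    rw [hδ2]
    nth_rw 1 [← Real.mul_self_sqrt hm0.le]
    field_simp
  -- The mesh n⁻³ beats the crude m ≤ 4n² up to logarithms, and x bounds all squared weights in the
  -- family.
  refine le_cubeRadius_of_family (G := n ^ 3) (T := ⌊Q⌋₊) (δ := δ) (a := a) (W := x) hm hb hb1 hb2
    (by positivity) (fun i => ⟨Nat.le_floor ((hbX i).trans (hbound (min_le_left _ _))),
      Nat.le_floor ((hbY i).trans (hbound (min_le_right _ _)))⟩) hα hβ hδ0 ha ha1 hA hη hαβ hq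
    (fun i => expWeight_sq_le hsX hsY hx1 (hbX i) (hbY i)) (by linarith) ?_ ?_ ?_ ?_ ?_
  · calc m * (x * δ ^ 2) = x * (m * δ ^ 2) := by ring
      _ = c * r ^ 2 := by rw [hmδ, hx, ht]; field_simp
      _ ≤ 1 * r ^ 2 := by gcongr
      _ = r ^ 2 := one_mul _
  · rwa [mul_comm, hmδ]
  · have hle : m * (8 * Real.pi * ((⌊Q⌋₊ : ℝ) ^ 2 * (1 / ((n ^ 3 : ℕ) : ℝ)))) ≤ a / 2 := by
      calc _ ≤ 4 * (n : ℝ) ^ 2 * (8 * Real.pi * (Q ^ 2 * (1 / (n : ℝ) ^ 3))) := by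
            push_cast
            gcongr
        _ = (32 * Real.pi * (1 / μ ^ 2) ^ 2 * Real.log n ^ 4) / n := by
            rw [hQ]; field_simp; ring
        _ ≤ a / 2 := (div_le_iff₀ hn0).2 h3
    refine hle.trans ?_
    gcongr
    exact le_div_self ha.le hδ0 hδ1
  · have h := net_size_bound (n := n) (T := ⌊Q⌋₊) (L := Q) (κ := a ^ 2 / 128 * (n : ℝ) ^ σ)
      (E := (a / δ) ^ 2 / (32 * m)) hn2 hT ?_ ?_ h2
    · exact_mod_cast h
    · refine le_of_eq_of_le ?_ h1
      rw [hQ]; ring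
    · have hE : (a / δ) ^ 2 / (32 * m) = a ^ 2 * n / (32 * (c * Real.sqrt m)) := by
        rw [div_pow, div_div, show δ ^ 2 * (32 * m) = 32 * (m * δ ^ 2) by ring, hmδ]
        field_simp
      rw [hE]
      exact deviation_exponent_bound hc0 hc1 hsm (by positivity) hsqrtn
  · refine le_of_eq_of_le ?_ hchi
    have hsq : m * (n * δ ^ 2) ^ 2 = lam := by
      rw [hδ2, ← Real.sq_sqrt hlam.le, ← hcdef, mul_pow, div_pow, mul_pow, Real.sq_sqrt hm0.le]
      field_simp
    rw [hsq]

theorem mainTheorem8 (α β : ℝ) (hα : α ∈ Set.Ioo (0 : ℝ) 1) (hβ : β ∈ Set.Ioo (0 : ℝ) 1)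
    (hαβ : α + β < 1) (sX sY A ε : ℝ) (hsX : 0 < sX) (hsY : 0 < sY) (hA : 1 < A) (hε : 0 < ε) :
    ∃ C : ℝ, 0 < C ∧ ∃ C' : ℝ, 0 < C' ∧ ∀ (n : ℕ) (r : ℝ), 1 ≤ n → 0 < r →
      r ^ 2 ≤ (n : ℝ) ^ (IndepTesting.meanSmoothness sX sY /
        (IndepTesting.meanSmoothness sX sY + IndepTesting.effectiveDim) - ε) →
      C' ≤ min (n : ℝ) (n * r ^ 2) →
      C * (IndepTesting.truncLevel sX sY (n * r ^ 2) : ℝ) ^ (1 / 4 : ℝ) / (n : ℝ) ^ (1 / 2 : ℝ) ≤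
        IndepTesting.cubeRadius n α β sX sY r A := by
  obtain ⟨hα0, hα1⟩ := hα
  obtain ⟨hβ0, hβ1⟩ := hβ
  set η := (1 - α - β) / 2 with hη
  have hη0 : 0 < η := by rw [hη]; linarith
  have hη1 : η ≤ 1 := by rw [hη]; linarith
  set lam := Real.log (1 + η ^ 2) with hlam
  have hlam0 : 0 < lam := Real.log_pos (by nlinarith)
  have hlam1 : lam ≤ 1 := by
    have := Real.log_le_sub_one_of_pos (by positivity : 0 < 1 + η ^ 2)
    nlinarith
  -- The budget 1 + η² = exp(lam) is split equally: exp(lam/2) for the second moment over all signs,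
  -- and q⁻² = exp(lam/2) for the discarded ones.
  set q := Real.exp (-(lam / 4)) with hq
  have hq1 : q < 1 := by rw [hq, Real.exp_lt_one_iff]; linarith
  have hchi : Real.exp (lam / 2) ≤ (1 + η ^ 2) * q ^ 2 := by
    rw [← Real.exp_log (by positivity : 0 < 1 + η ^ 2), ← hlam, hq, ← Real.exp_nat_mul,
      ← Real.exp_add]
    refine Real.exp_le_exp.2 (le_of_eq ?_)
    push_cast
    ring
  set a := min 1 (A - 1) with ha
  have ha0 : 0 < a := lt_min one_pos (by linarith)
  have haA : 1 + a ≤ A := by linarith [min_le_right 1 (A - 1)]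
  have hs := IndepTesting.meanSmoothness_pos hsX hsY
  have hc := IndepTesting.effectiveDim_nonneg
  set σ := IndepTesting.meanSmoothness sX sY /
    (IndepTesting.meanSmoothness sX sY + IndepTesting.effectiveDim) with hσ
  obtain ⟨n₀, hn₀⟩ := IndepTesting.exists_sample_size_threshold
    (K := 1 / min sX sY ^ 2) (κ := a ^ 2 / 128) (σ := σ) (by positivity) (by positivity) hq1 ha0
  obtain ⟨t₀, ht₀, htrunc⟩ := IndepTesting.exists_truncLevel_bounds sY hsX hsY
  refine ⟨Real.sqrt (Real.sqrt lam) / 2, by positivity, max (max 2 n₀) t₀, by positivity,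
    fun n r hn hr hrn hC => ?_⟩
  have hC1 := hC.trans (min_le_left _ _)
  have hC2 := hC.trans (min_le_right _ _)
  have hn2 : (2 : ℝ) ≤ n := ((le_max_left _ _).trans (le_max_left _ _)).trans hC1
  obtain ⟨h1, h2, h3⟩ := hn₀ n (((le_max_right _ _).trans (le_max_left _ _)).trans hC1)
  obtain ⟨h4, h5⟩ := htrunc (n * r ^ 2) ((le_max_right _ _).trans hC2)
  set M := IndepTesting.truncLevel sX sY (n * r ^ 2) with hM
  -- At M - 1 the defining inequality of the truncation level fails, which supplies enough pairs; as
  -- M ≥ 2, halving M at worst affects only the constant.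
  refine IndepTesting.le_cubeRadius_of_large hα0.le hβ0.le hsX hsY ha0 (min_le_left _ _) haA hη0
    (by rw [hη]; linarith) hlam0 hlam1 (Real.exp_pos _) hchi (m := M - 1) (by exact_mod_cast hn2) hr
    (by omega) (by omega) h5 (hrn.trans ?_) h1 h2 h3
    (IndepTesting.rpow_quarter_bound (Real.sqrt_nonneg _) (Nat.cast_nonneg _) (Nat.cast_nonneg _)
      (Nat.cast_nonneg _) ?_)
  · exact Real.rpow_le_rpow_of_exponent_le (by linarith) (by linarith)
  · exact_mod_cast (by omega : M ≤ 2 * (M - 1))
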